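/- Let $n$ be a positive integer, $k$ an integer, $0<\alpha\le 1$ with $k+\alpha\ge 0$, let $Y$ be a real Banach space with dual space $Y^*$, let $\mathscr D(\mathbf R^n,Y)$ be the space of smooth compactly supported functions $\mathbf R^n\to Y$ with its usual locally convex inductive limit topology, and let $T\in\mathscr D'(\mathbf R^n,Y)$, i.e. $T:\mathscr D(\mathbf R^n,Y)\to\mathbf R$ is linear and continuous. Definitions. A polynomial function of degree at most $-1$ is the zero function. For a polynomial function $P:\mathbf R^n\to Y^*$ let $S_P\in\mathscr D'(\mathbf R^n,Y)$ be given by $S_P(\phi)=\int P(x)(\phi(x))\,dx$. For $a\in\mathbf R^n$, $r>0$ and $\phi\in\mathscr D(\mathbf R^n,Y)$ let $\phi_{a,r}(x)=\phi(r^{-1}(x-a))$. (i) $T$ is *pointwise differentiable of order $(k,\alpha)$ at $a$* if there is a polynomial function $P:\mathbf R^n\to Y^*$ of degree at most $k$ with $$\limsup_{r\to0+} r^{-k-\alpha-n}\,(T-S_P)(\phi_{a,r})<\infty\quad\text{for every }\phi\in\mathscr D(\mathbf R^n,Y).$$ (ii) For an integer $m\ge 0$, $T$ is *pointwise differentiable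 of order $m$ at $a$* if there is a polynomial function $P:\mathbf R^n\to Y^*$ of degree at most $m$ with $$\lim_{r\to0+} r^{-m-n}\,(T-S_P)(\phi_{a,r})=0\quad\text{for every }\phi\in\mathscr D(\mathbf R^n,Y);$$ such $P$ is unique, and the *pointwise differential of order $m$ of $T$ at $a$* is $\operatorname{pt}D^mT(a)=D^mP(a)$. (iii) For an integer $k\ge 0$, a function $f:\mathbf R^n\to Y^*$ is *of class $(k,\alpha)$* if it is $k$ times continuously differentiable and every point of $\mathbf R^n$ has a neighbourhood on which $D^kf$ satisfies a Hölder condition with exponent $\alpha$. Theorem. Let $A$ be the set of all $a\in\mathbf R^n$ at which $T$ is pointwise differentiable of order $(k,\alpha)$. Then there is a sequence of compact sets $C_1,C_2,\dots\subset\mathbf R^n$ with $A=\bigcup_{j=1}^\infty C_j$ and, if $k\ge0$, there is also a sequence of functions $f_j:\mathbf R^n\to Y^*$ of class $(k,\alpha)$ such that, for every positive integer $j$, every $a\in C_j$ and every $m=0,\dots,k$, the distribution $T$ is pointwise differentiable of order $m$ at $a$ and $$\operatorname{pt}D^mT(a)=D^mf_j(a).$$ -/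

import Mathlib

open MeasureTheory Filter Set Topology TopologicalSpace
open scoped Distributions

noncomputable section

namespace PointwiseDiff

/-- The space `ℝⁿ` with its Euclidean norm. -/
abbrev Rn (n : ℕ) : Type := EuclideanSpace ℝ (Fin n)

/-- The locally convex space `𝓓(ℝⁿ, Y)` of smooth compactly supported functions `ℝⁿ → Y`, with
the usual inductive limit topology. -/
abbrev Test (n : ℕ) (Y : Type*) [NormedAddCommGroup Y] [NormedSpace ℝ Y] : Type _ :=
  𝓓((⊤ : Opens (Rn n)), Y)

/-- The space `𝓓'(ℝⁿ, Y)` of continuous linear functionals `𝓓(ℝⁿ, Y) → ℝ`. -/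
abbrev Distrib (n : ℕ) (Y : Type*) [NormedAddCommGroup Y] [NormedSpace ℝ Y] : Type _ :=
  Test n Y →L[ℝ] ℝ

/-- `P` is a polynomial function of degree at most `k`, i.e. a sum of (diagonals of) `m`-linear
maps with `0 ≤ m ≤ k`. For `k = -1` the sum is empty, so `P` is the zero function. -/
def IsPolyOfDegreeLE {E F : Type*} [NormedAddCommGroup E] [NormedSpace ℝ E]
    [NormedAddCommGroup F] [NormedSpace ℝ F] (k : ℤ) (P : E → F) : Prop :=
  ∃ p : (m : ℕ) → ContinuousMultilinearMap ℝ (fun _ : Fin m => E) F,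
    ∀ x, P x = ∑ m ∈ Finset.range (k + 1).toNat, p m (fun _ => x)

variable {n : ℕ} {Y : Type*} [NormedAddCommGroup Y] [NormedSpace ℝ Y]

theorem contDiff_dilate (a : Rn n) (r : ℝ) (φ : Test n Y) :
    ContDiff ℝ ((⊤ : ℕ∞) : WithTop ℕ∞) (fun x => φ (r⁻¹ • (x - a))) :=
  φ.contDiff.comp ((contDiff_id.sub contDiff_const).const_smul r⁻¹)

theorem hasCompactSupport_dilate (a : Rn n) {r : ℝ} (hr : r ≠ 0) (φ : Test n Y) :
    HasCompactSupport (fun x => φ (r⁻¹ • (x - a))) :=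
  φ.hasCompactSupport.comp_homeomorph
    ((Homeomorph.subRight a).trans (Homeomorph.smulOfNeZero r⁻¹ (inv_ne_zero hr)))

open Classical in
/-- The test function `x ↦ φ (r⁻¹ (x - a))`, for `r ≠ 0` (and by convention `0` if `r = 0`). -/
def dilate (a : Rn n) (r : ℝ) (φ : Test n Y) : Test n Y :=
  if hr : r ≠ 0 then
    ⟨fun x => φ (r⁻¹ • (x - a)), contDiff_dilate a r φ, hasCompactSupport_dilate a hr φ,
      fun _ _ => trivial⟩
  else 0

theorem dilate_apply (a : Rn n) {r : ℝ} (hr : r ≠ 0) (φ : Test n Y) (x : Rn n) :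
    dilate a r φ x = φ (r⁻¹ • (x - a)) := by
  rw [dilate, dif_pos hr]; rfl

/-- The distribution `S(φ) = ∫ ⟨φ(x), P(x)⟩ dx` associated with a locally integrable function
`P : ℝⁿ → Y*` (it is only used for polynomial functions `P`). -/
def ofFun (P : Rn n → StrongDual ℝ Y) : Distrib n Y :=
  TestFunction.integralAgainstBilinCLM (ContinuousLinearMap.id ℝ (StrongDual ℝ Y)).flip volume P

theorem IsPolyOfDegreeLE.continuous {E F : Type*} [NormedAddCommGroup E] [NormedSpace ℝ E]
    [NormedAddCommGroup F] [NormedSpace ℝ F] {k : ℤ} {P : E → F} (hP : IsPolyOfDegreeLE k P) :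
    Continuous P := by
  obtain ⟨p, hp⟩ := hP
  rw [funext hp]
  exact continuous_finsetSum _ fun m _ => (p m).cont.comp (continuous_pi fun _ => continuous_id)

theorem ofFun_apply {P : Rn n → StrongDual ℝ Y} (hP : Continuous P) (φ : Test n Y) :
    ofFun P φ = ∫ x, P x (φ x) := by
  rw [ofFun, TestFunction.integralAgainstBilinCLM_eq_integral
    (hP.locallyIntegrable.locallyIntegrableOn _)]
  rfl

/-- `P` is a polynomial function of degree at most `k` that witnesses pointwise differentiability
of order `k` of `T` at `a`. -/
def IsJetPoly (T : Distrib n Y) (k : ℤ) (a : Rn n) (P : Rn n → StrongDual ℝ Y) : Prop :=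
  IsPolyOfDegreeLE k P ∧ ∀ φ : Test n Y,
    Tendsto (fun r : ℝ => r ^ (-(k : ℝ) - n) * (T - ofFun P) (dilate a r φ)) (𝓝[>] 0) (𝓝 0)

/-- `T` is pointwise differentiable of order `k` at `a`. -/
def PtDiffAt (T : Distrib n Y) (k : ℤ) (a : Rn n) : Prop :=
  ∃ P : Rn n → StrongDual ℝ Y, IsJetPoly T k a P

open Classical in
/-- The pointwise differential `pt D^m T (a) = D^m P (a)` of order `m`, where `P` is the (unique)
polynomial function in the definition of pointwise differentiability of order `m` at `a`; by
convention `0` if `T` is not pointwise differentiable of order `m` at `a`. -/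
def ptD (m : ℕ) (T : Distrib n Y) (a : Rn n) :
    ContinuousMultilinearMap ℝ (fun _ : Fin m => Rn n) (StrongDual ℝ Y) :=
  if h : PtDiffAt T m a then iteratedFDeriv ℝ m h.choose a else 0

/-- `T` is pointwise differentiable of order `(k, α)` at `a`. The upper limit is taken in the
extended real numbers. -/
def PtDiffHolderAt (T : Distrib n Y) (k : ℤ) (α : ℝ) (a : Rn n) : Prop :=
  ∃ P : Rn n → StrongDual ℝ Y, IsPolyOfDegreeLE k P ∧ ∀ φ : Test n Y,
    limsup (fun r : ℝ =>
      ((r ^ (-(k : ℝ) - α - n) * (T - ofFun P) (dilate a r φ) : ℝ) : EReal)) (𝓝[>] 0) < ⊤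

/-- `f` is of class `(k, α)`: it is of class `C^k` and `D^k f` is locally Hölder continuous with
exponent `α`. -/
def IsOfClass {E F : Type*} [NormedAddCommGroup E] [NormedSpace ℝ E]
    [NormedAddCommGroup F] [NormedSpace ℝ F] (k : ℕ) (α : ℝ) (f : E → F) : Prop :=
  ContDiff ℝ k f ∧ ∀ a : E, ∃ U ∈ 𝓝 a, ∃ M : ℝ, ∀ x ∈ U, ∀ y ∈ U,
    ‖iteratedFDeriv ℝ k f x - iteratedFDeriv ℝ k f y‖ ≤ M * ‖x - y‖ ^ α

end PointwiseDiff

end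

/-! Write `s = k + α`. Let `approxSet T (k + 1).toNat s j` consist of the points `a` of the ball of
radius `j` having a polynomial `P` of degree at most `k` with `|(T - S_P)(φ_{a,r})| ≤ j B r^(s+n)`
for all `r ≤ 1/(j+1)` and all `φ` supported in the unit ball whose derivatives of order at most `j`
are bounded by `B`. These are the compact sets sought.

They exhaust `A` (`ptDiffHolderAt_iff`): test functions supported in the unit ball form a Baire
space, so the bounds for individual `φ` become uniform in finitely many seminorms
(`exists_uniform_bound`), and one large `j` dominates all the constants.

The central estimate is `exists_norm_sub_le_of_isApprox`. A smooth kernel of compact support that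
reproduces polynomials recovers values of `P` from `S_P`. Testing `T` with it at a point `x` and
scale `r`, where `x` is within `2r` of two points `a`, `b` of the set, gives `‖P_a(x) - P_b(x)‖ ≤ M
r^s`. This has two uses. Along a convergent sequence of points of the set the polynomials converge,
because `s` exceeds their degree, and the uniform bounds pass to the limit; so the set is closed
(`isClosed_approxSet`). Moreover it is Whitney's compatibility condition, so
`IsWhitneyField.exists_extension` yields `f_j` of class `(k, α)` with the jets of the `P_a`.

Finally, for `m ≤ k < s`, cutting the Taylor expansion of `P_a` at `a` after degree `m` gives the
polynomial that witnesses differentiability of order `m` (`IsApprox.exists_isJetPoly`); by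
uniqueness it is the one that defines `ptD`. -/

namespace PointwiseDiff

/-! ### Polynomial functions: interpolation, Markov's inequality, Taylor truncation. -/

section Polynomial

variable {E : Type*} [NormedAddCommGroup E] [NormedSpace ℝ E]
  {F : Type*} [NormedAddCommGroup F] [NormedSpace ℝ F]

/-- Weights that extract the coefficient of degree `e` of a polynomial of degree less than `N` from
its values at the nodes `(i + 1) / N`. -/
noncomputable def coeffWeight (N e i : ℕ) : ℝ :=
  (Lagrange.basis (Finset.range N) (fun i : ℕ => ((i : ℝ) + 1) / N) i).coeff e

theorem sum_coeffWeight (N e m : ℕ) (hm : m < N) :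
    ∑ i ∈ Finset.range N, coeffWeight N e i * (((i : ℝ) + 1) / N) ^ m = if m = e then 1 else 0 := by
  have hN : (N : ℝ) ≠ 0 := by
    have : 0 < N := by omega
    positivity
  have hinj : Set.InjOn (fun i : ℕ => ((i : ℝ) + 1) / N) (Finset.range N) := by
    intro i _ j _ h
    have : (i : ℝ) + 1 = j + 1 := by simpa [div_left_inj' hN] using h
    exact_mod_cast (add_right_cancel this)
  have h := Lagrange.eq_interpolate (F := ℝ) (f := Polynomial.X ^ m) hinj (by
    rw [Polynomial.degree_X_pow, Finset.card_range]; exact_mod_cast hm)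
  have h2 := congrArg (fun p => Polynomial.coeff p e) h
  simp only [Lagrange.interpolate_apply, Polynomial.finsetSum_coeff, Polynomial.coeff_C_mul,
    Polynomial.coeff_X_pow, Polynomial.eval_pow, Polynomial.eval_X] at h2
  simp only [eq_comm (a := m)]
  rw [h2]
  exact Finset.sum_congr rfl fun i _ => mul_comm _ _

theorem sum_coeffWeight_smul {N e : ℕ} (he : e < N) (w : ℕ → F) :
    ∑ i ∈ Finset.range N, coeffWeight N e i •
      ∑ m ∈ Finset.range N, (((i : ℝ) + 1) / N) ^ m • w m = w e := by
  simp_rw [Finset.smul_sum, smul_smul]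
  rw [Finset.sum_comm]
  have : ∀ m ∈ Finset.range N, ∑ i ∈ Finset.range N,
      (coeffWeight N e i * (((i : ℝ) + 1) / N) ^ m) • w m = if m = e then w m else 0 := by
    intro m hm
    rw [← Finset.sum_smul, sum_coeffWeight N e m (Finset.mem_range.1 hm)]
    split_ifs <;> simp
  rw [Finset.sum_congr rfl this, Finset.sum_ite_eq' _ e, if_pos (Finset.mem_range.2 he)]

theorem node_mem {N i : ℕ} (hi : i < N) : 0 < ((i : ℝ) + 1) / N ∧ ((i : ℝ) + 1) / N ≤ 1 := by
  have : 0 < N := by omega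
  refine ⟨by positivity, ?_⟩
  rw [div_le_one (by positivity)]
  exact_mod_cast hi

/-- `P` is a polynomial function of degree less than `N`. -/
def IsPolyLT (N : ℕ) (P : E → F) : Prop :=
  ∃ p : FormalMultilinearSeries ℝ E F, HasFiniteFPowerSeriesOnBall P p 0 N ⊤

theorem isPolyLT_of_expansion {N : ℕ} {P : E → F} {p : FormalMultilinearSeries ℝ E F} {a : E}
    (h : HasFiniteFPowerSeriesOnBall P p a N ⊤) : IsPolyLT N P := by
  have := h.changeOrigin (y := -a) (by simp)
  rw [add_neg_cancel] at this
  exact ⟨_, this.mono (by simp) (by simp)⟩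

theorem IsPolyLT.expansion {N : ℕ} {P : E → F} (hP : IsPolyLT N P) (a : E) :
    ∃ p : FormalMultilinearSeries ℝ E F, HasFiniteFPowerSeriesOnBall P p a N ⊤ := by
  obtain ⟨p, h⟩ := hP
  have := h.changeOrigin (y := a) (by simp)
  rw [zero_add] at this
  exact ⟨_, this.mono (by simp) (by simp)⟩

theorem isPolyLT_of_sum {N : ℕ} {P : E → F}
    (p : (m : ℕ) → ContinuousMultilinearMap ℝ (fun _ : Fin m => E) F) (a : E)
    (h : ∀ x, P x = ∑ m ∈ Finset.range N, p m (fun _ => x - a)) : IsPolyLT N P := by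
  refine isPolyLT_of_expansion (a := a) (p := fun m => if m < N then p m else 0) ?_
  refine HasFiniteFPowerSeriesOnBall.mk' (fun m hm => if_neg (by omega)) (by simp) ?_
  intro y _
  rw [h, add_sub_cancel_left]
  refine Finset.sum_congr rfl fun m hm => ?_
  rw [if_pos (Finset.mem_range.1 hm)]

theorem HasFiniteFPowerSeriesOnBall.eq_sum {N : ℕ} {P : E → F}
    {p : FormalMultilinearSeries ℝ E F} {a : E}
    (h : HasFiniteFPowerSeriesOnBall P p a N ⊤) (x : E) :
    P x = ∑ m ∈ Finset.range N, p m (fun _ => x - a) := by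
  have := h.eq_partialSum (y := x - a) (by simp) N le_rfl
  rw [add_sub_cancel] at this
  rw [this]; rfl

theorem isPolyOfDegreeLE_iff {k : ℤ} {P : E → F} :
    IsPolyOfDegreeLE k P ↔ IsPolyLT (k + 1).toNat P := by
  constructor
  · rintro ⟨p, hp⟩
    exact isPolyLT_of_sum p 0 (by simpa using hp)
  · rintro ⟨p, hp⟩
    exact ⟨p, fun x => by simpa using HasFiniteFPowerSeriesOnBall.eq_sum hp x⟩

theorem IsPolyLT.mono {N M : ℕ} {P : E → F} (hP : IsPolyLT N P) (h : N ≤ M) : IsPolyLT M P := by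
  obtain ⟨p, hp⟩ := hP
  exact ⟨p, hp.of_le h⟩

theorem IsPolyLT.sub {N : ℕ} {P Q : E → F} (hP : IsPolyLT N P) (hQ : IsPolyLT N Q) :
    IsPolyLT N (fun x => P x - Q x) := by
  obtain ⟨p, hp⟩ := hP
  obtain ⟨q, hq⟩ := hQ
  have := hp.sub hq
  rw [max_self] at this
  exact ⟨_, this⟩

theorem IsPolyLT.contDiff [CompleteSpace F] {N : ℕ} {P : E → F} (hP : IsPolyLT N P)
    {m : WithTop ℕ∞} : ContDiff ℝ m P := by
  rw [contDiff_iff_contDiffAt]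
  intro x
  obtain ⟨p, hp⟩ := hP.expansion x
  exact hp.toHasFPowerSeriesOnBall.analyticAt.contDiffAt

theorem IsPolyLT.fderiv [CompleteSpace F] {N : ℕ} {P : E → F} (hP : IsPolyLT N P) :
    IsPolyLT (N - 1) (fderiv ℝ P) := by
  obtain ⟨p, hp⟩ := hP
  exact ⟨_, hp.fderiv'⟩

theorem IsPolyLT.line {N : ℕ} {P : E → F} (hP : IsPolyLT N P) (z v : E) :
    ∃ w : ℕ → F, (∀ t : ℝ, P (z + t • v) = ∑ m ∈ Finset.range N, t ^ m • w m) ∧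
      w 1 = _root_.fderiv ℝ P z v := by
  obtain ⟨p, hp⟩ := hP.expansion z
  refine ⟨fun m => p m (fun _ => v), fun t => ?_, ?_⟩
  · rw [HasFiniteFPowerSeriesOnBall.eq_sum hp, add_sub_cancel_left]
    refine Finset.sum_congr rfl fun m _ => ?_
    have := (p m).map_smul_univ (fun _ => t) (fun _ => v)
    simpa using this
  · have := hp.toHasFPowerSeriesOnBall.hasFPowerSeriesAt.hasFDerivAt.fderiv
    rw [this, continuousMultilinearCurryFin1_apply]
    rfl

/-- All nodes are nonzero: the value at `z` comes from values away from `z`, which later permits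
dilated bumps as kernels. Using `N + 1` nodes keeps the case `N = 0` inside the interpolation
formula. -/
theorem IsPolyLT.apply_eq {N : ℕ} {P : E → F} (hP : IsPolyLT N P) (z v : E) :
    P z = ∑ i ∈ Finset.range (N + 1),
      coeffWeight (N + 1) 0 i • P (z + (((i : ℝ) + 1) / (N + 1 : ℕ)) • v) := by
  obtain ⟨w, hw, -⟩ := (hP.mono N.le_succ).line z v
  simp_rw [hw]
  rw [sum_coeffWeight_smul (by omega) w]
  have := hw 0
  rw [Finset.sum_range_succ'] at this
  simpa using this

theorem IsPolyLT.fderiv_apply_eq {N : ℕ} {P : E → F} (hP : IsPolyLT N P) (z v : E) :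
    _root_.fderiv ℝ P z v = ∑ i ∈ Finset.range (N + 2),
      coeffWeight (N + 2) 1 i • P (z + (((i : ℝ) + 1) / (N + 2 : ℕ)) • v) := by
  obtain ⟨w, hw, h1⟩ := (hP.mono (N.le_add_right 2)).line z v
  simp_rw [hw]
  rw [sum_coeffWeight_smul (by omega) w, h1]

/-- The constant in Markov's inequality for polynomials of degree less than `N`. -/
noncomputable def markovConst (N : ℕ) : ℝ := ∑ i ∈ Finset.range (N + 2), |coeffWeight (N + 2) 1 i|

theorem markovConst_nonneg (N : ℕ) : 0 ≤ markovConst N :=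
  Finset.sum_nonneg fun _ _ => abs_nonneg _

/-- Along a unit vector `v`, the derivative is `r⁻¹` times a fixed linear combination of values of
`P` at points of the segment from `x` to `x + r v`. -/
theorem IsPolyLT.norm_fderiv_le {N : ℕ} {P : E → F} (hP : IsPolyLT N P) (x : E) {r B : ℝ}
    (hr : 0 < r) (hB : ∀ z, ‖z - x‖ ≤ r → ‖P z‖ ≤ B) :
    ‖_root_.fderiv ℝ P x‖ ≤ markovConst N * r⁻¹ * B := by
  have hB0 : 0 ≤ B := (norm_nonneg _).trans (hB x (by simpa using hr.le))
  refine ContinuousLinearMap.opNorm_le_of_unit_norm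
    (mul_nonneg (mul_nonneg (markovConst_nonneg N) (inv_nonneg.2 hr.le)) hB0) fun v hv => ?_
  have h1 : _root_.fderiv ℝ P x v = r⁻¹ • _root_.fderiv ℝ P x (r • v) := by
    rw [map_smul, smul_smul, inv_mul_cancel₀ hr.ne', one_smul]
  rw [h1, norm_smul, hP.fderiv_apply_eq, Real.norm_of_nonneg (inv_nonneg.2 hr.le),
    mul_comm (markovConst N), mul_assoc]
  refine mul_le_mul_of_nonneg_left ?_ (inv_nonneg.2 hr.le)
  rw [markovConst, Finset.sum_mul]
  refine (norm_sum_le _ _).trans (Finset.sum_le_sum fun i hi => ?_)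
  rw [norm_smul, Real.norm_eq_abs]
  refine mul_le_mul_of_nonneg_left (hB _ ?_) (abs_nonneg _)
  obtain ⟨h0, h2⟩ := node_mem (Finset.mem_range.1 hi)
  rw [add_sub_cancel_left, norm_smul, norm_smul, hv, mul_one, Real.norm_of_nonneg h0.le,
    Real.norm_of_nonneg hr.le]
  exact mul_le_of_le_one_left hr.le h2

theorem IsPolyLT.iteratedFDeriv_eq_zero [CompleteSpace F] {N q : ℕ} {P : E → F}
    (hP : IsPolyLT N P) (hq : N ≤ q) (x : E) : iteratedFDeriv ℝ q P x = 0 := by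
  obtain ⟨p, hp⟩ := hP.expansion x
  ext v
  rw [hp.toHasFPowerSeriesOnBall.iteratedFDeriv_eq_sum_of_completeSpace]
  simp [hp.finite q hq]

/-- Each derivative costs one radius `r`, whence the ball of radius `q * r`. The target `F` is
quantified inside the induction since the step passes to `fderiv ℝ P`; with `E : Type` the space `E
→L[ℝ] F` stays in the universe of `F`. -/
theorem norm_iteratedFDeriv_le_of_isPolyLT_aux.{u} {E : Type} [NormedAddCommGroup E]
    [NormedSpace ℝ E] {N : ℕ} (q : ℕ) :
    ∀ {F : Type u} [NormedAddCommGroup F] [NormedSpace ℝ F] [CompleteSpace F] {P : E → F}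
      (_ : IsPolyLT N P) (x : E) {r B : ℝ} (_ : 0 < r)
      (_ : ∀ z, ‖z - x‖ ≤ q * r → ‖P z‖ ≤ B),
      ‖iteratedFDeriv ℝ q P x‖ ≤ (markovConst N * r⁻¹) ^ q * B := by
  induction q with
  | zero =>
    intro F _ _ _ P hP x r B hr hB
    simpa using hB x (by simp)
  | succ q ih =>
    intro F _ _ _ P hP x r B hr hB
    rw [← norm_iteratedFDeriv_fderiv, pow_succ, mul_assoc]
    refine ih (hP.fderiv.mono (Nat.sub_le _ _)) x hr fun z hz => hP.norm_fderiv_le z hr ?_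
    intro y hy
    refine hB y ?_
    calc ‖y - x‖ = ‖(y - z) + (z - x)‖ := by congr 1; abel
      _ ≤ r + q * r := (norm_add_le _ _).trans (add_le_add hy hz)
      _ = (q + 1 : ℕ) * r := by push_cast; ring

/-- Markov's inequality for the derivatives of polynomial functions. -/
theorem IsPolyLT.norm_iteratedFDeriv_le {E : Type} [NormedAddCommGroup E] [NormedSpace ℝ E]
    [CompleteSpace F] {N : ℕ} {P : E → F} (hP : IsPolyLT N P) (q : ℕ) (x : E) {r B : ℝ}
    (hr : 0 < r) (hB : ∀ z, ‖z - x‖ ≤ r → ‖P z‖ ≤ B) :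
    ‖iteratedFDeriv ℝ q P x‖ ≤ (markovConst N * (q + 1)) ^ q * (r⁻¹) ^ q * B := by
  have h := norm_iteratedFDeriv_le_of_isPolyLT_aux q hP x (r := r / (q + 1)) (B := B)
    (by positivity) fun z hz => hB z (hz.trans ?_)
  · rw [← mul_pow]
    rwa [inv_div, div_eq_mul_inv, ← mul_assoc] at h
  · rw [mul_div_assoc', div_le_iff₀ (by positivity)]
    nlinarith

theorem IsPolyLT.taylor [CompleteSpace F] {N : ℕ} {P : E → F} (hP : IsPolyLT N P) (a x : E) :
    P x = ∑ m ∈ Finset.range N,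
      ((m.factorial : ℝ)⁻¹ • iteratedFDeriv ℝ m P a) (fun _ => x - a) := by
  obtain ⟨p, hp⟩ := hP.expansion a
  rw [HasFiniteFPowerSeriesOnBall.eq_sum hp]
  refine Finset.sum_congr rfl fun m _ => ?_
  rw [smul_apply, ← hp.toHasFPowerSeriesOnBall.factorial_smul,
    ← Nat.cast_smul_eq_nsmul ℝ, smul_smul, inv_mul_cancel₀ (by positivity), one_smul]

/-- Truncation of the Taylor expansion of a polynomial function at a point. -/
theorem IsPolyLT.exists_truncation [CompleteSpace F] {N : ℕ} {P : E → F} (hP : IsPolyLT N P)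
    (a : E) (m : ℕ) :
    ∃ Q : E → F, IsPolyLT (m + 1) Q ∧ iteratedFDeriv ℝ m Q a = iteratedFDeriv ℝ m P a ∧
      ∃ C, 0 ≤ C ∧ ∀ x, ‖x - a‖ ≤ 1 → ‖P x - Q x‖ ≤ C * ‖x - a‖ ^ (m + 1) := by
  obtain ⟨p, hp⟩ := hP.expansion a
  have hq : HasFiniteFPowerSeriesOnBall
      (fun x => ∑ i ∈ Finset.range (m + 1), p i (fun _ => x - a))
      (fun i => if i < m + 1 then p i else 0) a (m + 1) ⊤ := by
    refine HasFiniteFPowerSeriesOnBall.mk' (fun i hi => if_neg (by omega)) (by simp) ?_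
    intro y _
    rw [add_sub_cancel_left]
    refine Finset.sum_congr rfl fun i hi => ?_
    rw [if_pos (Finset.mem_range.1 hi)]
  refine ⟨_, isPolyLT_of_expansion hq, ?_, ∑ i ∈ Finset.range N, ‖p i‖,
    Finset.sum_nonneg fun _ _ => norm_nonneg _, fun x hx => ?_⟩
  · ext v
    rw [hp.toHasFPowerSeriesOnBall.iteratedFDeriv_eq_sum_of_completeSpace,
      hq.toHasFPowerSeriesOnBall.iteratedFDeriv_eq_sum_of_completeSpace]
    simp
  -- Padding the expansion with zero terms allows splitting it at `m + 1` however `m` compares with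
  -- `N`.
  · have h1 : P x = ∑ i ∈ Finset.range (m + 1 + N), p i (fun _ => x - a) :=
      HasFiniteFPowerSeriesOnBall.eq_sum (hp.of_le (by omega)) x
    rw [h1, ← Finset.sum_range_add_sum_Ico _ (Nat.le_add_right (m + 1) N), add_sub_cancel_left]
    have h2 : ∀ i ∈ Finset.Ico (m + 1) (m + 1 + N),
        ‖p i (fun _ => x - a)‖ ≤ ‖p i‖ * ‖x - a‖ ^ (m + 1) := by
      intro i hi
      refine ((p i).le_opNorm _).trans (mul_le_mul_of_nonneg_left ?_ (norm_nonneg _))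
      simpa using pow_le_pow_of_le_one (norm_nonneg _) hx (Finset.mem_Ico.1 hi).1
    refine (norm_sum_le _ _).trans ((Finset.sum_le_sum h2).trans ?_)
    rw [← Finset.sum_mul]
    refine mul_le_mul_of_nonneg_right ?_ (by positivity)
    rw [← Finset.sum_filter_add_sum_filter_not (Finset.Ico (m + 1) (m + 1 + N)) (· < N)]
    have h3 : ∑ i ∈ Finset.Ico (m + 1) (m + 1 + N) with ¬ i < N, ‖p i‖ = 0 := by
      refine Finset.sum_eq_zero fun i hi => ?_
      rw [hp.finite i (not_lt.1 (Finset.mem_filter.1 hi).2), norm_zero]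
    rw [h3, add_zero]
    refine Finset.sum_le_sum_of_subset_of_nonneg (fun i hi => ?_) fun _ _ _ => norm_nonneg _
    exact Finset.mem_range.2 (Finset.mem_filter.1 hi).2

end Polynomial

/-! ### Smooth partitions of unity on a lattice. -/

section Lattice

theorem iteratedFDeriv_comp_smul_sub {E F : Type*} [NormedAddCommGroup E] [NormedSpace ℝ E]
    [NormedAddCommGroup F] [NormedSpace ℝ F] {f : E → F} {m : ℕ}
    (hf : ContDiff ℝ m f) (c : ℝ) (v x : E) :
    iteratedFDeriv ℝ m (fun x => f (c • x - v)) x = c ^ m • iteratedFDeriv ℝ m f (c • x - v) := by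
  have h := iteratedFDeriv_comp_const_smul (𝕜 := ℝ) (i := m) (f := fun y => f (y - v)) c
    (hf.comp (contDiff_id.sub contDiff_const))
  rw [h]
  simp only [iteratedFDeriv_comp_sub]

/-- A smooth function supported in `[-1, 1]` whose integer translates sum up to `1`. -/
noncomputable def hat (t : ℝ) : ℝ := Real.smoothTransition (t + 1) - Real.smoothTransition t

theorem contDiff_hat : ContDiff ℝ (⊤ : ℕ∞) hat :=
  (Real.smoothTransition.contDiff.comp (contDiff_id.add contDiff_const)).sub
    Real.smoothTransition.contDiff

theorem abs_le_one_of_hat_ne_zero {t : ℝ} (h : hat t ≠ 0) : |t| ≤ 1 := by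
  by_contra! h1
  apply h
  rcases lt_abs.1 h1 with h1 | h1
  · rw [hat, Real.smoothTransition.one_of_one_le (by linarith),
      Real.smoothTransition.one_of_one_le h1.le, sub_self]
  · rw [hat, Real.smoothTransition.zero_of_nonpos (by linarith),
      Real.smoothTransition.zero_of_nonpos (by linarith), sub_self]

/-- The sum telescopes to the difference of the smooth transition at `t + N + 1 ≥ 1` and at `t - N ≤
0`. -/
theorem sum_hat {t : ℝ} {N : ℕ} (ht : |t| ≤ N) :
    ∑ j ∈ Finset.range (2 * N + 1), hat (t - (j - N)) = 1 := by
  obtain ⟨h1, h2⟩ := abs_le.1 ht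
  have h := Finset.sum_range_sub' (fun j : ℕ => Real.smoothTransition (t + N + 1 - j)) (2 * N + 1)
  rw [Real.smoothTransition.one_of_one_le (by push_cast; linarith),
    Real.smoothTransition.zero_of_nonpos (by push_cast; linarith), sub_zero] at h
  rw [← h]
  refine Finset.sum_congr rfl fun j _ => ?_
  rw [hat]
  push_cast
  congr 2 <;> ring

/-- The tensor power of `hat`. -/
noncomputable def hatProd (n : ℕ) (x : Rn n) : ℝ := ∏ c, hat (x c)

theorem contDiff_hatProd (n : ℕ) : ContDiff ℝ (⊤ : ℕ∞) (hatProd n) := by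
  refine contDiff_prod fun c _ => contDiff_hat.comp ?_
  exact (EuclideanSpace.proj (𝕜 := ℝ) c).contDiff

theorem tsupport_hatProd_subset (n : ℕ) : tsupport (hatProd n) ⊆ {x | ∀ c, |x c| ≤ 1} := by
  refine closure_minimal (fun x hx c => ?_) ?_
  · exact abs_le_one_of_hat_ne_zero (Finset.prod_ne_zero_iff.1 hx c (Finset.mem_univ c))
  · simp only [ofPred_forall]
    refine isClosed_iInter fun c => isClosed_le (continuous_abs.comp ?_) continuous_const
    exact (EuclideanSpace.proj (𝕜 := ℝ) c).continuous

theorem norm_le_sqrt_of_forall_abs_le {n : ℕ} {x : Rn n} (hx : ∀ c, |x c| ≤ 1) :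
    ‖x‖ ≤ Real.sqrt n := by
  rw [EuclideanSpace.norm_eq]
  refine Real.sqrt_le_sqrt ?_
  calc ∑ c, ‖x c‖ ^ 2 ≤ ∑ _c : Fin n, (1 : ℝ) :=
        Finset.sum_le_sum fun c _ => pow_le_one₀ (norm_nonneg _) (hx c)
    _ = n := by simp

theorem hasCompactSupport_hatProd (n : ℕ) : HasCompactSupport (hatProd n) := by
  refine HasCompactSupport.of_support_subset_isCompact (isCompact_closedBall (0 : Rn n) (Real.sqrt n)) ?_
  intro x hx
  rw [mem_closedBall_zero_iff]
  exact norm_le_sqrt_of_forall_abs_le (tsupport_hatProd_subset n (subset_tsupport _ hx))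

theorem exists_bound_iteratedFDeriv {E F : Type*} [NormedAddCommGroup E] [NormedSpace ℝ E]
    [NormedAddCommGroup F] [NormedSpace ℝ F] {f : E → F} {m : ℕ} (hf : ContDiff ℝ m f)
    (hs : HasCompactSupport f) : ∃ B, 0 ≤ B ∧ ∀ x, ‖iteratedFDeriv ℝ m f x‖ ≤ B := by
  obtain ⟨B, hB⟩ := (hs.iteratedFDeriv m).exists_bound_of_continuous
    (hf.continuous_iteratedFDeriv le_rfl)
  exact ⟨max B 0, le_max_right _ _, fun x => (hB x).trans (le_max_left _ _)⟩

theorem card_filter_abs_sub_le (s : Finset ℕ) (τ : ℝ) :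
    (s.filter fun j : ℕ => |τ - j| ≤ 1).card ≤ 3 := by
  have : (s.filter fun j : ℕ => |τ - j| ≤ 1) ⊆ Finset.Icc ⌈τ - 1⌉₊ (⌈τ - 1⌉₊ + 2) := by
    intro j hj
    obtain ⟨h1, h2⟩ := abs_le.1 (Finset.mem_filter.1 hj).2
    rw [Finset.mem_Icc]
    refine ⟨Nat.ceil_le.2 (by linarith), ?_⟩
    have := Nat.le_ceil (τ - 1)
    have h3 : (j : ℝ) ≤ (⌈τ - 1⌉₊ + 2 : ℕ) := by push_cast; linarith
    exact_mod_cast h3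
  refine (Finset.card_le_card this).trans ?_
  rw [Nat.card_Icc]
  omega

/-- Partitions of unity at scale `δ` near a bounded set `S`. -/
theorem exists_partition (n : ℕ) : ∃ K : ℝ, 1 ≤ K ∧ ∃ A : ℕ → ℝ, (∀ m, 0 ≤ A m) ∧
    ∀ S : Set (Rn n), Bornology.IsBounded S → ∀ δ : ℝ, 0 < δ →
      ∃ (I : Finset (Fin n → ℕ)) (ψ : (Fin n → ℕ) → Rn n → ℝ) (b : (Fin n → ℕ) → Rn n),
        (∀ i ∈ I, b i ∈ S) ∧
        (∀ i ∈ I, ContDiff ℝ (⊤ : ℕ∞) (ψ i)) ∧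
        (∀ i ∈ I, HasCompactSupport (ψ i)) ∧
        (∀ i ∈ I, ∀ m x, iteratedFDeriv ℝ m (ψ i) x ≠ 0 → ‖x - b i‖ ≤ K * δ) ∧
        (∀ m x, ∑ i ∈ I, ‖iteratedFDeriv ℝ m (ψ i) x‖ ≤ A m * (δ⁻¹) ^ m) ∧
        ∀ x, (∃ c ∈ S, ‖x - c‖ < 2 * δ) → ∑ i ∈ I, ψ i x = 1 := by
  classical
  have hsm : ∀ m : ℕ, ContDiff ℝ m (hatProd n) := fun m =>
    (contDiff_hatProd n).of_le (by exact_mod_cast le_top)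
  choose B hB0 hB using fun m : ℕ =>
    exists_bound_iteratedFDeriv (hsm m) (hasCompactSupport_hatProd n)
  -- The support of `ψ i` lies within `√n δ` of its lattice point, which lies within `(√n + 2) δ` of
  -- `b i ∈ S`; the sum gives `K`. At most `3 ^ n` of the functions are active at any point.
  refine ⟨2 * Real.sqrt n + 2, by have := Real.sqrt_nonneg n; linarith, fun m => 3 ^ n * B m,
    fun m => by have := hB0 m; positivity, fun S hS δ hδ => ?_⟩
  obtain ⟨R, hR⟩ := hS.exists_norm_le
  -- A finite box of the lattice suffices: points within `2δ` of `S` have norm at most `R + 2δ`,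
  -- hence rescaled coordinates at most `N`.
  obtain ⟨N, hN⟩ := exists_nat_ge (δ⁻¹ * R + 2)
  set v : (Fin n → ℕ) → Rn n := fun i => WithLp.toLp 2 fun c => (i c : ℝ) - N with hv
  set ψ : (Fin n → ℕ) → Rn n → ℝ := fun i x => hatProd n (δ⁻¹ • x - v i) with hψ
  set I : Finset (Fin n → ℕ) := (Fintype.piFinset fun _ => Finset.range (2 * N + 1)).filter
    fun i => ∃ c ∈ S, ‖δ • v i - c‖ ≤ (Real.sqrt n + 2) * δ with hI
  have hIS : ∀ i, ∃ b, i ∈ I → b ∈ S ∧ ‖δ • v i - b‖ ≤ (Real.sqrt n + 2) * δ := by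
    intro i
    by_cases hi : i ∈ I
    · obtain ⟨c, hc⟩ := (Finset.mem_filter.1 hi).2
      exact ⟨c, fun _ => hc⟩
    · exact ⟨0, fun h => absurd h hi⟩
  choose b hb using hIS
  have hcoord : ∀ i x c, (δ⁻¹ • x - v i) c = δ⁻¹ * x c - ((i c : ℝ) - N) := fun i x c => by
    simp [hv]
  have hder : ∀ i m x, iteratedFDeriv ℝ m (ψ i) x =
      (δ⁻¹) ^ m • iteratedFDeriv ℝ m (hatProd n) (δ⁻¹ • x - v i) := fun i m x =>
    iteratedFDeriv_comp_smul_sub (hsm m) _ _ _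
  have hsupp : ∀ i m x, iteratedFDeriv ℝ m (ψ i) x ≠ 0 → ∀ c, |(δ⁻¹ • x - v i) c| ≤ 1 := by
    intro i m x h
    rw [hder] at h
    have h1 := (smul_ne_zero_iff.1 h).2
    exact tsupport_hatProd_subset n (support_iteratedFDeriv_subset m h1)
  have hdist : ∀ i x, ‖δ⁻¹ • x - v i‖ ≤ Real.sqrt n → ‖x - δ • v i‖ ≤ Real.sqrt n * δ := by
    intro i x h
    have : x - δ • v i = δ • (δ⁻¹ • x - v i) := by
      rw [smul_sub, smul_smul, mul_inv_cancel₀ hδ.ne', one_smul]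
    rw [this, norm_smul, Real.norm_of_nonneg hδ.le, mul_comm]
    exact mul_le_mul_of_nonneg_right h hδ.le
  refine ⟨I, ψ, b, fun i hi => (hb i hi).1, fun i _ => ?_, fun i _ => ?_, fun i hi m x h => ?_,
    fun m x => ?_, fun x hx => ?_⟩
  · exact (contDiff_hatProd n).comp ((contDiff_const_smul δ⁻¹).sub contDiff_const)
  · exact (hasCompactSupport_hatProd n).comp_homeomorph
      ((Homeomorph.smulOfNeZero δ⁻¹ (inv_ne_zero hδ.ne')).trans (Homeomorph.subRight (v i)))
  · have h1 := hdist i x (norm_le_sqrt_of_forall_abs_le (hsupp i m x h))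
    have h2 := norm_add_le (x - δ • v i) (δ • v i - b i)
    rw [sub_add_sub_cancel] at h2
    have := (hb i hi).2
    linarith
  · set J := I.filter fun i => iteratedFDeriv ℝ m (ψ i) x ≠ 0 with hJ
    have h1 : ∑ i ∈ I, ‖iteratedFDeriv ℝ m (ψ i) x‖ = ∑ i ∈ J, ‖iteratedFDeriv ℝ m (ψ i) x‖ := by
      rw [hJ, Finset.sum_filter (s := I)]
      refine Finset.sum_congr rfl fun i _ => ?_
      split_ifs with h
      · rfl
      · rw [not_not.1 h, norm_zero]
    have h2 : J ⊆ Fintype.piFinset fun c =>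
        (Finset.range (2 * N + 1)).filter fun j : ℕ => |δ⁻¹ * x c + N - j| ≤ 1 := by
      intro i hi
      obtain ⟨hi1, hi2⟩ := Finset.mem_filter.1 hi
      rw [Fintype.mem_piFinset]
      intro c
      refine Finset.mem_filter.2 ⟨Fintype.mem_piFinset.1 (Finset.mem_filter.1 hi1).1 c, ?_⟩
      have := hsupp i m x hi2 c
      rw [hcoord] at this
      convert this using 2; ring
    have h3 : J.card ≤ 3 ^ n := by
      refine (Finset.card_le_card h2).trans ?_
      rw [Fintype.card_piFinset]
      refine (Finset.prod_le_prod' fun c _ => card_filter_abs_sub_le _ _).trans ?_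
      simp
    rw [h1]
    calc ∑ i ∈ J, ‖iteratedFDeriv ℝ m (ψ i) x‖ ≤ ∑ _i ∈ J, B m * (δ⁻¹) ^ m := by
          refine Finset.sum_le_sum fun i _ => ?_
          rw [hder, norm_smul, norm_pow, Real.norm_of_nonneg (inv_nonneg.2 hδ.le), mul_comm]
          exact mul_le_mul_of_nonneg_right (hB m _) (by positivity)
      _ = J.card * (B m * (δ⁻¹) ^ m) := by rw [Finset.sum_const, nsmul_eq_mul]
      _ ≤ 3 ^ n * (B m * (δ⁻¹) ^ m) := by
          have := hB0 m
          refine mul_le_mul_of_nonneg_right ?_ (by positivity)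
          exact_mod_cast h3
      _ = 3 ^ n * B m * (δ⁻¹) ^ m := by ring
  · obtain ⟨c, hc, hxc⟩ := hx
    have h1 : ∑ i ∈ I, ψ i x = ∑ i ∈ Fintype.piFinset fun _ => Finset.range (2 * N + 1), ψ i x := by
      refine Finset.sum_subset (Finset.filter_subset _ _) fun i hi hiI => ?_
      by_contra h
      apply hiI
      refine Finset.mem_filter.2 ⟨hi, c, hc, ?_⟩
      have h2 := hdist i x (norm_le_sqrt_of_forall_abs_le
        (tsupport_hatProd_subset n (subset_tsupport _ h)))
      have h3 := norm_add_le (δ • v i - x) (x - c)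
      rw [sub_add_sub_cancel, norm_sub_rev (δ • v i) x] at h3
      linarith
    rw [h1]
    have h2 : ∀ i, ψ i x = ∏ c, hat (δ⁻¹ * x c - ((i c : ℝ) - N)) := fun i => by
      simp only [hψ, hatProd, hcoord]
    simp_rw [h2]
    rw [← Finset.prod_univ_sum (fun _ => Finset.range (2 * N + 1))
      (fun c j => hat (δ⁻¹ * x c - ((j : ℝ) - N)))]
    refine Finset.prod_eq_one fun d _ => sum_hat ?_
    have h3 : |x d| ≤ ‖x‖ := by simpa using PiLp.norm_apply_le x d
    have h4 : ‖x‖ ≤ R + 2 * δ := by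
      have := norm_add_le (x - c) c
      rw [sub_add_cancel] at this
      have := hR c hc
      linarith
    rw [abs_mul, abs_of_nonneg (inv_nonneg.2 hδ.le)]
    calc δ⁻¹ * |x d| ≤ δ⁻¹ * (R + 2 * δ) :=
          mul_le_mul_of_nonneg_left (h3.trans h4) (inv_nonneg.2 hδ.le)
      _ = δ⁻¹ * R + 2 := by rw [mul_add]; congr 1; field_simp
      _ ≤ N := hN

end Lattice

/-! ### Whitney's extension theorem by successive corrections. -/

section WhitneyExtension

variable {n : ℕ} {F : Type*} [NormedAddCommGroup F] [NormedSpace ℝ F]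

/-- By Leibniz, `l` derivatives of `ψ i` cost `δ^(-l)` and the other `m - l` leave `δ^(s-m+l)`, so
every term has size `δ^(s-m)`. Bounds on `g i` are needed only where `ψ i` is active. -/
theorem norm_iteratedFDeriv_sum_smul_le {ι : Type*} {I : Finset ι} {ψ : ι → Rn n → ℝ}
    {g : ι → Rn n → F} {A : ℕ → ℝ} {δ s G : ℝ} {m : ℕ} {x : Rn n} (hδ : 0 < δ) (hG : 0 ≤ G)
    (hψ : ∀ i ∈ I, ContDiff ℝ m (ψ i)) (hg : ∀ i ∈ I, ContDiff ℝ m (g i))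
    (hA : ∀ l, ∑ i ∈ I, ‖iteratedFDeriv ℝ l (ψ i) x‖ ≤ A l * (δ⁻¹) ^ l)
    (hgb : ∀ i ∈ I, (∃ l, iteratedFDeriv ℝ l (ψ i) x ≠ 0) → ∀ q ≤ m,
      ‖iteratedFDeriv ℝ q (g i) x‖ ≤ G * δ ^ (s - q)) :
    ‖iteratedFDeriv ℝ m (fun y => ∑ i ∈ I, ψ i y • g i y) x‖ ≤
      (∑ l ∈ Finset.range (m + 1), (m.choose l : ℝ) * A l) * G * δ ^ (s - m) := by
  rw [iteratedFDeriv_fun_sum_apply (f := fun i y => ψ i y • g i y) fun i hi => ((hψ i hi).smul (hg i hi)).contDiffAt]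
  calc ‖∑ i ∈ I, iteratedFDeriv ℝ m (fun y => ψ i y • g i y) x‖
      ≤ ∑ i ∈ I, ∑ l ∈ Finset.range (m + 1), (m.choose l : ℝ) *
          ‖iteratedFDeriv ℝ l (ψ i) x‖ * ‖iteratedFDeriv ℝ (m - l) (g i) x‖ :=
        (norm_sum_le _ _).trans (Finset.sum_le_sum fun i hi =>
          norm_iteratedFDeriv_smul_le (hψ i hi) (hg i hi) x le_rfl)
    _ ≤ ∑ i ∈ I, ∑ l ∈ Finset.range (m + 1), (m.choose l : ℝ) *
          ‖iteratedFDeriv ℝ l (ψ i) x‖ * (G * δ ^ (s - (m - l : ℕ))) := by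
        refine Finset.sum_le_sum fun i hi => Finset.sum_le_sum fun l _ => ?_
        by_cases h : iteratedFDeriv ℝ l (ψ i) x = 0
        · simp [h]
        · exact mul_le_mul_of_nonneg_left (hgb i hi ⟨l, h⟩ _ (Nat.sub_le _ _)) (by positivity)
    _ = ∑ l ∈ Finset.range (m + 1), (m.choose l : ℝ) *
          (∑ i ∈ I, ‖iteratedFDeriv ℝ l (ψ i) x‖) * (G * δ ^ (s - (m - l : ℕ))) := by
        rw [Finset.sum_comm]
        simp_rw [Finset.mul_sum, Finset.sum_mul]
    _ ≤ ∑ l ∈ Finset.range (m + 1), (m.choose l : ℝ) *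
          (A l * (δ⁻¹) ^ l) * (G * δ ^ (s - (m - l : ℕ))) := by
        refine Finset.sum_le_sum fun l _ => mul_le_mul_of_nonneg_right
          (mul_le_mul_of_nonneg_left (hA l) (by positivity)) (by positivity)
    _ = _ := by
        rw [Finset.sum_mul, Finset.sum_mul]
        refine Finset.sum_congr rfl fun l hl => ?_
        have hl' : l ≤ m := Nat.lt_succ_iff.1 (Finset.mem_range.1 hl)
        have : δ ^ (s - (m - l : ℕ)) = δ ^ (s - m) * δ ^ l := by
          rw [← Real.rpow_natCast δ l, ← Real.rpow_add hδ]
          congr 1; push_cast [hl']; ring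
        rw [this, inv_pow]
        field_simp

theorem rpow_sub_natCast_le {L δ s : ℝ} (hL : 1 ≤ L) (hδ : 0 < δ) (q : ℕ) :
    (L * δ) ^ (s - q) ≤ L ^ s * δ ^ (s - q) := by
  rw [Real.mul_rpow (by linarith) hδ.le]
  refine mul_le_mul_of_nonneg_right (Real.rpow_le_rpow_of_exponent_le hL ?_) (by positivity)
  linarith [(Nat.cast_nonneg q : (0 : ℝ) ≤ q)]

/-- A family of polynomial functions of degree at most `k` over `S` that satisfies Whitney's
compatibility condition of order `s`. -/
structure IsWhitneyField (S : Set (Rn n)) (k : ℕ) (s : ℝ) (P : Rn n → Rn n → F) (M r₀ : ℝ) :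
    Prop where
  isPolyLT : ∀ a ∈ S, IsPolyLT (k + 1) (P a)
  nonneg : 0 ≤ M
  pos : 0 < r₀
  bound : ∀ a ∈ S, ∀ b ∈ S, ∀ r, 0 < r → r ≤ r₀ → ‖a - b‖ ≤ r → ∀ x, ‖x - a‖ ≤ r →
    ‖P b x - P a x‖ ≤ M * r ^ s

/-- Markov's inequality on the ball of radius `r` about `x`, which stays within `2r` of `a`. -/
theorem IsWhitneyField.exists_bound_iteratedFDeriv [CompleteSpace F] {S : Set (Rn n)} {k : ℕ}
    {s : ℝ} {P : Rn n → Rn n → F} {M r₀ : ℝ} (h : IsWhitneyField S k s P M r₀) :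
    ∃ M', 0 ≤ M' ∧ ∀ a ∈ S, ∀ b ∈ S, ∀ r, 0 < r → 2 * r ≤ r₀ → ‖a - b‖ ≤ r → ∀ x, ‖x - a‖ ≤ r →
      ∀ q ≤ k + 1, ‖iteratedFDeriv ℝ q (fun y => P b y - P a y) x‖ ≤ M' * r ^ (s - q) := by
  set c : ℕ → ℝ := fun q => (markovConst (k + 1) * (q + 1)) ^ q with hc
  have hc0 : ∀ q, 0 ≤ c q := fun q => by have := markovConst_nonneg (k + 1); positivity
  have hM := h.nonneg
  refine ⟨(∑ q ∈ Finset.range (k + 2), c q) * (M * 2 ^ s),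
    mul_nonneg (Finset.sum_nonneg fun q _ => hc0 q) (by positivity), ?_⟩
  intro a ha b hb r hr hr0 hab x hx q hq
  have h1 := ((h.isPolyLT b hb).sub (h.isPolyLT a ha)).norm_iteratedFDeriv_le q x hr
    (B := M * (2 * r) ^ s) fun z hz => h.bound a ha b hb (2 * r) (by positivity) hr0
      (hab.trans (by linarith)) z (by
        have := norm_add_le (z - x) (x - a)
        rw [sub_add_sub_cancel] at this
        linarith)
  refine h1.trans ?_
  have h2 : (markovConst (k + 1) * (q + 1)) ^ q ≤ ∑ q ∈ Finset.range (k + 2), c q :=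
    Finset.single_le_sum (f := c) (fun q _ => hc0 q) (Finset.mem_range.2 (by omega))
  have h3 : r⁻¹ ^ q * (M * (2 * r) ^ s) = M * 2 ^ s * r ^ (s - q) := by
    rw [Real.mul_rpow (by norm_num) hr.le, Real.rpow_sub hr, Real.rpow_natCast, inv_pow]
    ring
  rw [mul_assoc, h3, mul_assoc (∑ q ∈ Finset.range (k + 2), c q)]
  exact mul_le_mul_of_nonneg_right h2 (by positivity)

/-- Smooth approximations `u j` at scales `δ j` decreasing geometrically: each new one glues the
polynomials `P b` within about `δ j` of `S` and keeps the previous function elsewhere. No Whitney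
cubes are required, as each scale has its own uniform partition. -/
theorem exists_whitney_approximation [CompleteSpace F] {S : Set (Rn n)}
    (hS : Bornology.IsBounded S) {k : ℕ}
    {α : ℝ} (hα1 : α ≤ 1) {P : Rn n → Rn n → F} {M r₀ : ℝ}
    (h : IsWhitneyField S k (k + α) P M r₀) :
    ∃ (u : ℕ → Rn n → F) (δ₀ θ C : ℝ), 0 < δ₀ ∧ 0 < θ ∧ θ < 1 ∧ 0 ≤ C ∧
      (∀ j, ContDiff ℝ (⊤ : ℕ∞) (u j)) ∧
      (∀ j, ∀ a ∈ S, ∀ m ≤ k + 1, ‖iteratedFDeriv ℝ m (fun y => u j y - P a y) a‖ ≤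
        C * (δ₀ * θ ^ j) ^ (k + α - m)) ∧
      (∀ j x, ∀ m ≤ k + 1, ‖iteratedFDeriv ℝ m (fun y => u (j + 1) y - u j y) x‖ ≤
        C * (δ₀ * θ ^ (j + 1)) ^ (k + α - m)) ∧
      (∀ j x, ‖iteratedFDeriv ℝ (k + 1) (u j) x‖ ≤ C * (δ₀ * θ ^ j) ^ (α - 1)) := by
  obtain ⟨K, hK1, A, hA0, hpart⟩ := exists_partition n
  obtain ⟨M', hM', hcompat⟩ := h.exists_bound_iteratedFDeriv
  have hPs : ∀ a ∈ S, ∀ m : WithTop ℕ∞, ContDiff ℝ m (P a) := fun a ha m => (h.isPolyLT a ha).contDiff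
  choose I ψ b hbS hψ hψc hψd hψA hψ1 using fun δ : {δ : ℝ // 0 < δ} => hpart S hS δ.1 δ.2
  set s : ℝ := k + α with hs
  set D : ℝ := ∑ m ∈ Finset.range (k + 2), ∑ l ∈ Finset.range (m + 1), (m.choose l : ℝ) * A l
    with hD
  have hD0 : 0 ≤ D := Finset.sum_nonneg fun m _ => Finset.sum_nonneg fun l _ =>
    mul_nonneg (by positivity) (hA0 l)
  have hDm : ∀ m ≤ k + 1, ∑ l ∈ Finset.range (m + 1), (m.choose l : ℝ) * A l ≤ D := fun m hm =>
    Finset.single_le_sum (f := fun m => ∑ l ∈ Finset.range (m + 1), (m.choose l : ℝ) * A l)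
      (fun m _ => Finset.sum_nonneg fun l _ => mul_nonneg (by positivity) (hA0 l))
      (Finset.mem_range.2 (by omega))
  -- With this ratio of scales, the correction at scale `δ (j + 1)` lives within `K δ (j + 1) ≤ δ j`
  -- of `S`, where `u j` is already known to be close to the field.
  set L : ℝ := 2 * K with hL
  have hL2 : 2 ≤ L := by linarith
  have hL0 : 0 < L := by linarith
  have hr0 := h.pos
  -- Ensures `2 * (L * δ j) ≤ r₀`, the range in which compatibility is available.
  set δ₀ : ℝ := r₀ / (2 * L) with hδ₀
  have hδ₀0 : 0 < δ₀ := by positivity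
  set δ : ℕ → ℝ := fun j => δ₀ * L⁻¹ ^ j with hδ
  have hδ0 : ∀ j, 0 < δ j := fun j => by positivity
  have hδs : ∀ j, δ j = L * δ (j + 1) := fun j => by
    simp only [hδ, pow_succ]; field_simp
  have hδle : ∀ j, δ j ≤ δ₀ := fun j =>
    mul_le_of_le_one_right hδ₀0.le (pow_le_one₀ (by positivity) (inv_le_one_of_one_le₀ (by linarith)))
  set W : ℕ → (Rn n → F) → Rn n → F := fun j u x =>
    u x + ∑ i ∈ I ⟨δ j, hδ0 j⟩, ψ ⟨δ j, hδ0 j⟩ i x • (P (b ⟨δ j, hδ0 j⟩ i) x - u x) with hW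
  set u : ℕ → Rn n → F := fun j => Nat.rec (W 0 0) (fun j u => W (j + 1) u) j with hu
  have hu0 : u 0 = W 0 0 := rfl
  have hus : ∀ j, u (j + 1) = W (j + 1) (u j) := fun j => rfl
  have hWs : ∀ j v, ContDiff ℝ (⊤ : ℕ∞) v → ContDiff ℝ (⊤ : ℕ∞) (W j v) := fun j v hv =>
    hv.add (ContDiff.sum fun i hi => (hψ _ i hi).smul ((hPs _ (hbS _ i hi) _).sub hv))
  have husm : ∀ j, ContDiff ℝ (⊤ : ℕ∞) (u j) := by
    intro j
    induction j with
    | zero => exact hWs 0 0 contDiff_const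
    | succ j ih => exact hWs _ _ ih
  have hnat : ∀ {v : Rn n → F} (m : ℕ), ContDiff ℝ (⊤ : ℕ∞) v → ContDiff ℝ m v := fun m hv =>
    hv.of_le (by exact_mod_cast le_top)
  have hnat' : ∀ {v : Rn n → ℝ} (m : ℕ), ContDiff ℝ (⊤ : ℕ∞) v → ContDiff ℝ m v := fun m hv =>
    hv.of_le (by exact_mod_cast le_top)
  -- near `S` the operator `W` replaces any function by an approximation of the field
  have hWA : ∀ j v, ∀ a ∈ S, ∀ x, ‖x - a‖ ≤ δ j → ∀ m ≤ k + 1,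
      ‖iteratedFDeriv ℝ m (fun y => W j v y - P a y) x‖ ≤ D * (M' * L ^ s) * δ j ^ (s - m) := by
    intro j v a ha x hx m hm
    set d : {δ : ℝ // 0 < δ} := ⟨δ j, hδ0 j⟩ with hd
    have hev : (fun y => W j v y - P a y) =ᶠ[𝓝 x]
        fun y => ∑ i ∈ I d, ψ d i y • (P (b d i) y - P a y) := by
      have : Metric.ball a (2 * δ j) ∈ 𝓝 x := Metric.isOpen_ball.mem_nhds (by
        rw [Metric.mem_ball, dist_eq_norm]; linarith [hδ0 j])
      filter_upwards [this] with y hy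
      have h1 := hψ1 d y ⟨a, ha, by rwa [Metric.mem_ball, dist_eq_norm] at hy⟩
      -- Since the `ψ i` sum to `1` here, `v` cancels and only differences of field polynomials
      -- remain.
      simp only [hW, smul_sub, Finset.sum_sub_distrib, ← Finset.sum_smul]
      rw [h1, one_smul, one_smul]
      abel
    rw [(hev.iteratedFDeriv ℝ m).eq_of_nhds]
    refine (norm_iteratedFDeriv_sum_smul_le (s := s) (hδ0 j) (by positivity : 0 ≤ M' * L ^ s)
      (fun i hi => hnat' m (hψ d i hi)) (fun i hi => (hPs _ (hbS d i hi) _).sub (hPs a ha _))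
      (fun l => hψA d l x) ?_).trans ?_
    · rintro i hi ⟨l, hl⟩ q hq
      have h1 := hψd d i hi l x hl
      have h2 : ‖a - b d i‖ ≤ L * δ j := by
        have := norm_add_le (a - x) (x - b d i)
        rw [sub_add_sub_cancel, norm_sub_rev a x] at this
        have h3 : δ j ≤ K * δ j := le_mul_of_one_le_left (hδ0 j).le hK1
        have h4 : d.1 = δ j := rfl
        rw [h4] at h1
        rw [hL]; linarith
      have h5 : δ j ≤ L * δ j := le_mul_of_one_le_left (hδ0 j).le (by linarith)
      refine (hcompat a ha _ (hbS d i hi) (L * δ j) (mul_pos hL0 (hδ0 j)) ?_ h2 x (hx.trans h5) q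
        (hq.trans hm)).trans ?_
      · calc 2 * (L * δ j) ≤ 2 * (L * δ₀) := by have := hδle j; gcongr
          _ = r₀ := by rw [hδ₀]; field_simp
      · rw [mul_assoc M']
        exact mul_le_mul_of_nonneg_left (rpow_sub_natCast_le (L := L) (by linarith) (hδ0 j) q) hM'
    · have := hδ0 j
      gcongr
      exact hDm m hm
  have huA : ∀ j, ∀ a ∈ S, ∀ x, ‖x - a‖ ≤ δ j → ∀ m ≤ k + 1,
      ‖iteratedFDeriv ℝ m (fun y => u j y - P a y) x‖ ≤ D * (M' * L ^ s) * δ j ^ (s - m) := by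
    intro j
    cases j with
    | zero => exact hWA 0 0
    | succ j => exact hWA (j + 1) (u j)
  set C1 : ℝ := D * (M' * L ^ s) with hC1
  have hC10 : 0 ≤ C1 := by positivity
  have hdiff : ∀ j, (fun y => u (j + 1) y - u j y) = fun y =>
      ∑ i ∈ I ⟨δ (j + 1), hδ0 (j + 1)⟩, ψ ⟨δ (j + 1), hδ0 (j + 1)⟩ i y •
        (P (b ⟨δ (j + 1), hδ0 (j + 1)⟩ i) y - u j y) := by
    intro j; ext y
    rw [hus]
    exact add_sub_cancel_left _ _
  -- The constant `G` is left free: at distance more than `δ j` from `S` the hypothesis is vacuous,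
  -- and `G = 0` shows that the correction has vanishing derivatives there.
  have hdG : ∀ j x (G : ℝ), 0 ≤ G → (∀ a ∈ S, ‖x - a‖ ≤ δ j → ∀ q ≤ k + 1,
      ‖iteratedFDeriv ℝ q (fun y => P a y - u j y) x‖ ≤ G * δ (j + 1) ^ (s - q)) →
      ∀ m ≤ k + 1, ‖iteratedFDeriv ℝ m (fun y => u (j + 1) y - u j y) x‖ ≤
        D * G * δ (j + 1) ^ (s - m) := by
    intro j x G hG hb' m hm
    rw [hdiff]
    refine (norm_iteratedFDeriv_sum_smul_le (s := s) (hδ0 (j + 1)) hG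
      (fun i hi => hnat' m (hψ _ i hi)) (fun i hi => (hPs _ (hbS _ i hi) _).sub (hnat m (husm j)))
      (fun l => hψA _ l x) ?_).trans ?_
    · rintro i hi ⟨l, hl⟩ q hq
      refine hb' _ (hbS _ i hi) ?_ q (hq.trans hm)
      refine (hψd _ i hi l x hl).trans ?_
      rw [hδs j]
      exact mul_le_mul_of_nonneg_right (by linarith) (hδ0 _).le
    · have := hδ0 (j + 1)
      gcongr
      exact hDm m hm
  set G : ℝ := C1 * L ^ s with hG
  have hG0 : 0 ≤ G := by positivity
  have hdB : ∀ j x, ∀ m ≤ k + 1, ‖iteratedFDeriv ℝ m (fun y => u (j + 1) y - u j y) x‖ ≤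
      D * G * δ (j + 1) ^ (s - m) := by
    intro j x
    refine hdG j x G hG0 fun a ha hx q hq => ?_
    have h1 := huA j a ha x hx q hq
    have h2 : (fun y => P a y - u j y) = -(fun y => u j y - P a y) := by
      ext y; exact (neg_sub _ _).symm
    rw [h2, iteratedFDeriv_neg, Pi.neg_apply, norm_neg]
    refine h1.trans ?_
    rw [hG, mul_assoc C1, hδs j]
    exact mul_le_mul_of_nonneg_left (rpow_sub_natCast_le (L := L) (by linarith) (hδ0 _) q) hC10
  have hu0c : HasCompactSupport (u 0) := by
    have : u 0 = fun x => ∑ i ∈ I ⟨δ 0, hδ0 0⟩, ψ ⟨δ 0, hδ0 0⟩ i x • P (b ⟨δ 0, hδ0 0⟩ i) x := by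
      ext x; simp [hu0, hW]
    rw [this]
    refine HasCompactSupport.intro
      ((I ⟨δ 0, hδ0 0⟩).isCompact_biUnion fun i hi => hψc ⟨δ 0, hδ0 0⟩ i hi) fun x hx => ?_
    refine Finset.sum_eq_zero fun i hi => ?_
    rw [image_eq_zero_of_notMem_tsupport (fun h => hx (mem_biUnion hi h)), zero_smul]
  obtain ⟨B, hB0, hB⟩ := exists_bound_iteratedFDeriv (hnat (k + 1) (husm 0)) hu0c
  have hexp : s - (k + 1 : ℕ) = α - 1 := by rw [hs]; push_cast; ring
  set C : ℝ := C1 + D * G + B * δ₀ ^ (1 - α) with hC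
  have hBδ : 0 ≤ B * δ₀ ^ (1 - α) := by positivity
  have hDG : 0 ≤ D * G := by positivity
  have hδ1 : ∀ j, δ j ^ (α - 1) ≤ δ (j + 1) ^ (α - 1) := fun j => by
    refine Real.rpow_le_rpow_of_nonpos (hδ0 _) ?_ (by linarith)
    rw [hδs j]
    exact le_mul_of_one_le_left (hδ0 _).le (by linarith)
  refine ⟨u, δ₀, L⁻¹, C, hδ₀0, by positivity, inv_lt_one_of_one_lt₀ (by linarith), by positivity,
    husm, fun j a ha m hm => ?_, fun j x m hm => ?_, fun j x => ?_⟩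
  · refine (huA j a ha a (by simpa using (hδ0 j).le) m hm).trans ?_
    exact mul_le_mul_of_nonneg_right (by linarith) (Real.rpow_nonneg (hδ0 j).le _)
  · refine (hdB j x m hm).trans ?_
    exact mul_le_mul_of_nonneg_right (by linarith) (Real.rpow_nonneg (hδ0 (j + 1)).le _)
  · induction j with
    | zero =>
      refine (hB x).trans ?_
      have h1 : B = B * δ₀ ^ (1 - α) * (δ₀ * L⁻¹ ^ 0) ^ (α - 1) := by
        rw [pow_zero, mul_one, mul_assoc, ← Real.rpow_add hδ₀0]; simp
      calc B = B * δ₀ ^ (1 - α) * (δ₀ * L⁻¹ ^ 0) ^ (α - 1) := h1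
        _ ≤ _ := mul_le_mul_of_nonneg_right (by linarith) (Real.rpow_nonneg (hδ0 0).le _)
    | succ j ih =>
      have hsplit : iteratedFDeriv ℝ (k + 1) (u (j + 1)) x = iteratedFDeriv ℝ (k + 1) (u j) x +
          iteratedFDeriv ℝ (k + 1) (fun y => u (j + 1) y - u j y) x := by
        have : u (j + 1) = u j + fun y => u (j + 1) y - u j y := by ext y; simp
        conv_lhs => rw [this]
        exact iteratedFDeriv_add_apply (hnat _ (husm j)).contDiffAt
          (hnat _ ((husm (j + 1)).sub (husm j))).contDiffAt
      rw [hsplit]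
      -- Adding up the bounds of all corrections would diverge for `α = 1`. Instead, near `S` the
      -- bound on `u j` comes directly from the field, as `D^(k+1) (P a) = 0`; far from `S` the
      -- function does not change and induction applies.
      by_cases hx : ∃ a ∈ S, ‖x - a‖ ≤ δ j
      · obtain ⟨a, ha, hxa⟩ := hx
        have h1 := huA j a ha x hxa (k + 1) le_rfl
        have h2 : iteratedFDeriv ℝ (k + 1) (fun y => u j y - P a y) x =
            iteratedFDeriv ℝ (k + 1) (u j) x := by
          have := iteratedFDeriv_sub_apply (𝕜 := ℝ) (hnat (k + 1) (husm j)).contDiffAt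
            (hPs a ha (k + 1 : ℕ)).contDiffAt (x := x)
          rw [(h.isPolyLT a ha).iteratedFDeriv_eq_zero le_rfl, sub_zero] at this
          exact this
        have h3 := hdB j x (k + 1) le_rfl
        rw [h2] at h1
        rw [hexp] at h1 h3
        have h4 := mul_le_mul_of_nonneg_left (hδ1 j) hC10
        have h5 := mul_nonneg hBδ (Real.rpow_nonneg (hδ0 (j + 1)).le (α - 1))
        calc _ ≤ _ := norm_add_le _ _
          _ ≤ C1 * δ (j + 1) ^ (α - 1) + D * G * δ (j + 1) ^ (α - 1) := by linarith
          _ ≤ C * δ (j + 1) ^ (α - 1) := by rw [hC]; linarith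
      · have h1 := hdG j x 0 le_rfl (fun a ha hxa => absurd ⟨a, ha, hxa⟩ hx) (k + 1) le_rfl
        have h2 : iteratedFDeriv ℝ (k + 1) (fun y => u (j + 1) y - u j y) x = 0 := by
          simpa using h1
        rw [h2, add_zero]
        exact ih.trans (mul_le_mul_of_nonneg_left (hδ1 j) (by positivity))

/-- **Whitney's extension theorem** for functions of class `(k, α)` with values in a Banach
space. -/
theorem IsWhitneyField.exists_extension [CompleteSpace F] {S : Set (Rn n)}
    (hS : Bornology.IsBounded S) {k : ℕ} {α : ℝ} (hα0 : 0 < α) (hα1 : α ≤ 1)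
    {P : Rn n → Rn n → F} {M r₀ : ℝ} (h : IsWhitneyField S k (k + α) P M r₀) :
    ∃ f : Rn n → F, IsOfClass k α f ∧
      ∀ a ∈ S, ∀ m ≤ k, iteratedFDeriv ℝ m f a = iteratedFDeriv ℝ m (P a) a := by
  obtain ⟨u, δ₀, θ, C, hδ₀, hθ0, hθ1, hC, husm, huP, hud, huk⟩ :=
    exists_whitney_approximation hS hα1 h
  have hnat : ∀ j (m : ℕ), ContDiff ℝ m (u j) := fun j m => (husm j).of_le (by exact_mod_cast le_top)
  have hρ0 : ∀ m : ℕ, 0 < θ ^ (k + α - m) := fun m => Real.rpow_pos_of_pos hθ0 _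
  have hρ1 : ∀ m ≤ k, θ ^ (k + α - m) < 1 := fun m hm =>
    Real.rpow_lt_one hθ0.le hθ1 (by have : (m : ℝ) ≤ k := by exact_mod_cast hm
                                    linarith)
  have hpow : ∀ (m j : ℕ), (δ₀ * θ ^ j) ^ (k + α - m) =
      δ₀ ^ (k + α - m) * (θ ^ (k + α - m)) ^ j := fun m j => by
    rw [Real.mul_rpow hδ₀.le (by positivity), ← Real.rpow_natCast θ j, ← Real.rpow_mul hθ0.le,
      mul_comm (j : ℝ), Real.rpow_mul hθ0.le, Real.rpow_natCast]
  set v : ℕ → ℕ → ℝ := fun m j => C * (δ₀ * θ ^ (j + 1)) ^ (k + α - m) with hv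
  have hvs : ∀ m ≤ k, Summable (v m) := fun m hm => by
    have : v m = fun j => C * δ₀ ^ (k + α - m) * θ ^ (k + α - m) * (θ ^ (k + α - m)) ^ j := by
      ext j
      simp only [hv]
      rw [hpow, pow_succ]
      ring
    rw [this]
    exact (summable_geometric_of_lt_one (hρ0 m).le (hρ1 m hm)).mul_left _
  set d : ℕ → Rn n → F := fun j x => u (j + 1) x - u j x with hd
  have hdsm : ∀ j (m : ℕ), ContDiff ℝ m (d j) := fun j m => (hnat _ m).sub (hnat _ m)
  set g : Rn n → F := fun x => ∑' j, d j x with hg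
  -- For `m ≤ k` the ratio `θ^(k+α-m)` is less than `1`, so the corrections sum in `C^k`.
  have hvs' : ∀ m : ℕ, (m : ℕ∞) ≤ (k : ℕ∞) → Summable (v m) := fun m hm =>
    hvs m (by exact_mod_cast hm)
  have hdv : ∀ (m j : ℕ) (x : Rn n), (m : ℕ∞) ≤ (k : ℕ∞) →
      ‖iteratedFDeriv ℝ m (d j) x‖ ≤ v m j := fun m j x hm =>
    hud j x m (by have : m ≤ k := by exact_mod_cast hm
                  omega)
  have hgsm : ContDiff ℝ k g := contDiff_tsum (N := (k : ℕ∞)) (fun j => hdsm j k) hvs' hdv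
  have hgD : ∀ m ≤ k, ∀ x, HasSum (fun j => iteratedFDeriv ℝ m (d j) x) (iteratedFDeriv ℝ m g x) := by
    intro m hm x
    have hm' : (m : ℕ∞) ≤ (k : ℕ∞) := by exact_mod_cast hm
    rw [hg, iteratedFDeriv_tsum_apply (N := (k : ℕ∞)) (fun j => hdsm j k) hvs' hdv hm' x]
    exact (Summable.of_norm_bounded (hvs m hm) fun j => hdv m j x hm').hasSum
  set f : Rn n → F := u 0 + g with hf
  have hfsm : ContDiff ℝ k f := (hnat 0 k).add hgsm
  have hfD : ∀ m ≤ k, ∀ x, Tendsto (fun J => iteratedFDeriv ℝ m (u J) x) atTop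
      (𝓝 (iteratedFDeriv ℝ m f x)) := by
    intro m hm x
    have h1 := ((hgD m hm x).tendsto_sum_nat).const_add (iteratedFDeriv ℝ m (u 0) x)
    have h2 : iteratedFDeriv ℝ m f x = iteratedFDeriv ℝ m (u 0) x + iteratedFDeriv ℝ m g x :=
      iteratedFDeriv_add_apply (hnat 0 m).contDiffAt
        (hgsm.of_le (by exact_mod_cast hm)).contDiffAt
    rw [h2]
    refine h1.congr fun J => ?_
    have h3 : ∀ j, iteratedFDeriv ℝ m (d j) x =
        iteratedFDeriv ℝ m (u (j + 1)) x - iteratedFDeriv ℝ m (u j) x := fun j =>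
      iteratedFDeriv_sub_apply (hnat _ m).contDiffAt (hnat _ m).contDiffAt
    simp only [h3, Finset.sum_range_sub (fun j => iteratedFDeriv ℝ m (u j) x)]
    abel
  refine ⟨f, ⟨hfsm, fun a => ?_⟩, fun a ha m hm => ?_⟩
  · set ρ := θ ^ (k + α - k) with hρ
    have hρα : ρ = θ ^ α := by rw [hρ]; congr 1; ring
    set C' : ℝ := C * δ₀ ^ α / (1 - ρ) with hC'
    have h1ρ : 0 < 1 - ρ := by have := hρ1 k le_rfl; linarith
    have hC'0 : 0 ≤ C' := by positivity
    have hpowα : ∀ j : ℕ, (δ₀ * θ ^ j) ^ α = δ₀ ^ α * ρ ^ j := fun j => by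
      have := hpow k j
      rw [add_sub_cancel_left] at this
      rw [this, hρα]
    have htail : ∀ J x, ‖iteratedFDeriv ℝ k (u J) x - iteratedFDeriv ℝ k f x‖ ≤
        C' * ρ ^ J := by
      intro J x
      have := dist_le_of_le_geometric_of_tendsto ρ (C * δ₀ ^ α) (hρ1 k le_rfl)
        (f := fun J => iteratedFDeriv ℝ k (u J) x) (fun j => ?_) (hfD k le_rfl x) J
      · rw [dist_eq_norm] at this
        refine this.trans (le_of_eq ?_)
        rw [hC']; ring
      · have h1 := hud j x k (by omega)
        have h2 : iteratedFDeriv ℝ k (fun y => u (j + 1) y - u j y) x =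
            iteratedFDeriv ℝ k (u (j + 1)) x - iteratedFDeriv ℝ k (u j) x :=
          iteratedFDeriv_sub_apply (hnat _ k).contDiffAt (hnat _ k).contDiffAt
        rw [dist_eq_norm, norm_sub_rev, ← h2]
        refine h1.trans ?_
        rw [add_sub_cancel_left, hpowα, pow_succ, mul_assoc]
        refine mul_le_mul_of_nonneg_left ?_ hC
        refine mul_le_mul_of_nonneg_left ?_ (by positivity)
        exact mul_le_of_le_one_right (pow_nonneg (hρ0 k).le _) (hρ1 k le_rfl).le
    refine ⟨Metric.ball a (δ₀ / 2), Metric.ball_mem_nhds a (by positivity),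
      (2 * C' / δ₀ ^ α + C) * (θ⁻¹) ^ α, fun x hx y hy => ?_⟩
    rcases eq_or_ne x y with rfl | hxy
    · simp [Real.zero_rpow hα0.ne']
    have ht0 : 0 < ‖x - y‖ := norm_pos_iff.2 (sub_ne_zero.2 hxy)
    have ht1 : ‖x - y‖ ≤ δ₀ := by
      rw [← dist_eq_norm]
      rw [Metric.mem_ball] at hx hy
      have := dist_triangle_right x y a
      linarith
    -- Choose the scale comparable to `‖x - y‖`: the mean value theorem handles `D^k (u J)`, and the
    -- tail of the series, of size `(δ₀ θ^J)^α`, handles the rest.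
    obtain ⟨J, hJ1, hJ2⟩ := exists_nat_pow_near_of_lt_one (x := ‖x - y‖ / δ₀) (by positivity)
      ((div_le_one hδ₀).2 ht1) hθ0 hθ1
    rw [lt_div_iff₀ hδ₀] at hJ1
    rw [div_le_iff₀ hδ₀] at hJ2
    have hmv : ‖iteratedFDeriv ℝ k (u J) x - iteratedFDeriv ℝ k (u J) y‖ ≤
        C * (δ₀ * θ ^ J) ^ (α - 1) * ‖x - y‖ := by
      refine Convex.norm_image_sub_le_of_norm_fderiv_le (𝕜 := ℝ) (s := univ) (fun z _ => ?_)
        (fun z _ => ?_) convex_univ (mem_univ _) (mem_univ _)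
      · exact ((husm J).differentiable_iteratedFDeriv (m := k)
          (by exact_mod_cast WithTop.coe_lt_top k)) z
      · rw [norm_fderiv_iteratedFDeriv]
        exact huk J z
    have hδJ : 0 < δ₀ * θ ^ J := by positivity
    have h1 : C * (δ₀ * θ ^ J) ^ (α - 1) * ‖x - y‖ ≤ C * (δ₀ * θ ^ J) ^ α := by
      have : (δ₀ * θ ^ J) ^ α = (δ₀ * θ ^ J) ^ (α - 1) * (δ₀ * θ ^ J) := by
        rw [← Real.rpow_add_one hδJ.ne']; congr 1; ring
      rw [this, mul_assoc]
      refine mul_le_mul_of_nonneg_left ?_ hC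
      refine mul_le_mul_of_nonneg_left ?_ (by positivity)
      linarith
    have h2 : (δ₀ * θ ^ J) ^ α ≤ (θ⁻¹) ^ α * ‖x - y‖ ^ α := by
      rw [← Real.mul_rpow (by positivity) ht0.le]
      refine Real.rpow_le_rpow hδJ.le ?_ hα0.le
      rw [inv_mul_eq_div, le_div_iff₀ hθ0]
      calc δ₀ * θ ^ J * θ = θ ^ (J + 1) * δ₀ := by ring
        _ ≤ _ := hJ1.le
    have h3 : C' * ρ ^ J = C' / δ₀ ^ α * (δ₀ * θ ^ J) ^ α := by
      rw [hpowα]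
      have : δ₀ ^ α ≠ 0 := (Real.rpow_pos_of_pos hδ₀ _).ne'
      field_simp
    have h4 := htail J x
    have h5 := htail J y
    rw [h3] at h4 h5
    rw [norm_sub_rev] at h4
    calc ‖iteratedFDeriv ℝ k f x - iteratedFDeriv ℝ k f y‖
        = ‖(iteratedFDeriv ℝ k f x - iteratedFDeriv ℝ k (u J) x) +
            (iteratedFDeriv ℝ k (u J) x - iteratedFDeriv ℝ k (u J) y) +
            (iteratedFDeriv ℝ k (u J) y - iteratedFDeriv ℝ k f y)‖ := by congr 1; abel
      _ ≤ _ := norm_add₃_le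
      _ ≤ (2 * C' / δ₀ ^ α + C) * (δ₀ * θ ^ J) ^ α := by
        have h6 : 2 * C' / δ₀ ^ α = 2 * (C' / δ₀ ^ α) := by ring
        rw [h6]
        linarith
      _ ≤ (2 * C' / δ₀ ^ α + C) * ((θ⁻¹) ^ α * ‖x - y‖ ^ α) :=
        mul_le_mul_of_nonneg_left h2 (by positivity)
      _ = _ := by ring
  · refine tendsto_nhds_unique (hfD m hm a) ?_
    rw [tendsto_iff_norm_sub_tendsto_zero]
    have hlim : Tendsto (fun j : ℕ => C * (δ₀ * θ ^ j) ^ (k + α - m)) atTop (𝓝 0) := by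
      simp only [hpow]
      have := ((tendsto_pow_atTop_nhds_zero_of_lt_one (hρ0 m).le (hρ1 m hm)).const_mul
        (δ₀ ^ (k + α - m))).const_mul C
      simpa using this
    refine squeeze_zero (fun _ => norm_nonneg _) (fun j => ?_) hlim
    have h1 := huP j a ha m (by omega)
    have h2 : iteratedFDeriv ℝ m (fun y => u j y - P a y) a =
        iteratedFDeriv ℝ m (u j) a - iteratedFDeriv ℝ m (P a) a :=
      iteratedFDeriv_sub_apply (hnat _ m).contDiffAt ((h.isPolyLT a ha).contDiff).contDiffAt
    rwa [h2] at h1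

end WhitneyExtension

/-! ### Seminorm bounds and dilations of test functions. -/

section TestFunctions

variable {n : ℕ} {Y : Type*} [NormedAddCommGroup Y] [NormedSpace ℝ Y]

/-- The derivatives of `φ` of order at most `l` are bounded by `B`. -/
def DerivLE (l : ℕ) (B : ℝ) (φ : Rn n → Y) : Prop :=
  ∀ i ≤ l, ∀ x, ‖iteratedFDeriv ℝ i φ x‖ ≤ B

theorem DerivLE.nonneg {l : ℕ} {B : ℝ} {φ : Rn n → Y} (h : DerivLE l B φ) : 0 ≤ B :=
  (norm_nonneg _).trans (h 0 (Nat.zero_le _) 0)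

theorem DerivLE.mono {l l' : ℕ} {B : ℝ} {φ : Rn n → Y} (h : DerivLE l' B φ) (hl : l ≤ l') :
    DerivLE l B φ := fun i hi => h i (hi.trans hl)

theorem exists_derivLE (l : ℕ) (φ : Test n Y) : ∃ B, DerivLE l B φ := by
  choose B hB0 hB using fun m : ℕ => exists_bound_iteratedFDeriv (m := m)
    (φ.contDiff.of_le (by exact_mod_cast le_top)) φ.hasCompactSupport
  refine ⟨∑ i ∈ Finset.range (l + 1), B i, fun i hi x => (hB i x).trans ?_⟩
  exact Finset.single_le_sum (f := B) (fun i _ => hB0 i) (Finset.mem_range.2 (by omega))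

/-- A test function with support in `K` as an element of `𝓓_K`. -/
noncomputable def toSupportedIn (K : Compacts (Rn n)) (φ : Test n Y) (hφ : tsupport φ ⊆ K) : 𝓓_{K}(Rn n, Y) :=
  ⟨φ, φ.contDiff, fun _ hx => image_eq_zero_of_notMem_tsupport fun h => hx (hφ h)⟩

theorem seminorm_toSupportedIn_le {K : Compacts (Rn n)} {φ : Test n Y} (hφ : tsupport φ ⊆ K)
    {l : ℕ} {B : ℝ} (h : DerivLE l B φ) {i : ℕ} (hi : i ≤ l) :
    ContDiffMapSupportedIn.seminorm ℝ (Rn n) Y ⊤ K i (toSupportedIn K φ hφ) ≤ B :=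
  (ContDiffMapSupportedIn.seminorm_top_le_iff ℝ h.nonneg i _).2 fun x _ => h i hi x

/-- A distribution has finite order on every compact set. -/
theorem exists_order_bound (T : Distrib n Y) (K : Compacts (Rn n)) :
    ∃ (l : ℕ) (C : ℝ), 0 ≤ C ∧ ∀ φ : Test n Y, tsupport φ ⊆ K → ∀ B, DerivLE l B φ →
      |T φ| ≤ C * B := by
  have hK : (K : Set (Rn n)) ⊆ (⊤ : Opens (Rn n)) := fun _ _ => trivial
  set L : 𝓓_{K}(Rn n, Y) →L[ℝ] ℝ := T.comp (TestFunction.ofSupportedInCLM ℝ hK) with hL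
  obtain ⟨s, C, -, hC⟩ := Seminorm.bound_of_continuous
    (ContDiffMapSupportedIn.withSeminorms ℝ (Rn n) Y ⊤ K)
    ((normSeminorm ℝ ℝ).comp L.toLinearMap) (continuous_norm.comp L.continuous)
  refine ⟨s.sup id, C, C.2, fun φ hφ B hB => ?_⟩
  have h1 := hC (toSupportedIn K φ hφ)
  have h2 : L (toSupportedIn K φ hφ) = T φ := rfl
  have h3 : |T φ| ≤ C * (s.sup (ContDiffMapSupportedIn.seminorm ℝ (Rn n) Y ⊤ K))
      (toSupportedIn K φ hφ) := by
    rw [← h2]; exact h1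
  refine h3.trans (mul_le_mul_of_nonneg_left ?_ C.2)
  exact Seminorm.finset_sup_apply_le hB.nonneg fun i hi =>
    seminorm_toSupportedIn_le hφ hB (Finset.le_sup (f := id) hi)

theorem dilate_add (a : Rn n) (r : ℝ) (φ ψ : Test n Y) :
    dilate a r (φ + ψ) = dilate a r φ + dilate a r ψ := by
  by_cases hr : r = 0
  · simp [dilate, hr]
  · ext x; simp [dilate_apply a hr]

theorem dilate_smul (a : Rn n) (r c : ℝ) (φ : Test n Y) :
    dilate a r (c • φ) = c • dilate a r φ := by
  by_cases hr : r = 0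
  · simp [dilate, hr]
  · ext x; simp [dilate_apply a hr]

theorem dilate_dilate (a c : Rn n) {R ρ : ℝ} (hR : R ≠ 0) (hρ : ρ ≠ 0) (φ : Test n Y) :
    dilate a R (dilate c ρ φ) = dilate (a + R • c) (R * ρ) φ := by
  ext x
  rw [dilate_apply a hR, dilate_apply c hρ, dilate_apply _ (mul_ne_zero hR hρ)]
  congr 1
  rw [mul_inv_rev, mul_smul, smul_sub R⁻¹, smul_sub R⁻¹, smul_add, smul_smul R⁻¹ R,
    inv_mul_cancel₀ hR, one_smul, sub_sub, smul_sub]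

theorem tsupport_dilate_subset {φ : Test n Y} {ρ r : ℝ}
    (hφ : tsupport φ ⊆ Metric.closedBall 0 ρ) (a : Rn n) (hr : 0 < r) :
    tsupport (dilate a r φ) ⊆ Metric.closedBall a (r * ρ) := by
  refine closure_minimal (fun x hx => ?_) Metric.isClosed_closedBall
  rw [Function.mem_support, dilate_apply a hr.ne'] at hx
  have := hφ (subset_tsupport _ hx)
  rw [mem_closedBall_zero_iff, norm_smul, Real.norm_of_nonneg (inv_nonneg.2 hr.le),
    inv_mul_le_iff₀ hr] at this
  rwa [Metric.mem_closedBall, dist_eq_norm]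

theorem iteratedFDeriv_dilate (a : Rn n) {r : ℝ} (hr : r ≠ 0) (φ : Test n Y) (i : ℕ) (x : Rn n) :
    iteratedFDeriv ℝ i (dilate a r φ) x = (r⁻¹) ^ i • iteratedFDeriv ℝ i φ (r⁻¹ • (x - a)) := by
  have h1 : (dilate a r φ : Rn n → Y) = fun x => φ (r⁻¹ • x - r⁻¹ • a) := by
    ext y; rw [dilate_apply a hr, smul_sub]
  rw [h1, iteratedFDeriv_comp_smul_sub (φ.contDiff.of_le (by exact_mod_cast le_top)), smul_sub]

theorem DerivLE.dilate {l : ℕ} {B r : ℝ} {φ : Test n Y} (h : DerivLE l B φ) (a : Rn n)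
    (hr : 0 < r) (hr1 : r ≤ 1) : DerivLE l ((r⁻¹) ^ l * B) (dilate a r φ) := by
  intro i hi x
  rw [iteratedFDeriv_dilate a hr.ne', norm_smul, norm_pow, Real.norm_of_nonneg (inv_nonneg.2 hr.le)]
  have h1 : (1 : ℝ) ≤ r⁻¹ := (one_le_inv₀ hr).2 hr1
  exact mul_le_mul (pow_le_pow_right₀ h1 hi) (h i hi _) (norm_nonneg _) (by positivity)

theorem ofFun_dilate {P : Rn n → StrongDual ℝ Y} (hP : Continuous P) (a : Rn n) {r : ℝ}
    (hr : 0 < r) (φ : Test n Y) :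
    ofFun P (dilate a r φ) = r ^ n * ∫ x, P (a + r • x) (φ x) := by
  rw [ofFun_apply hP]
  have h1 : ∀ x, P x (dilate a r φ x) =
      (fun z => P (a + r • z) (φ z)) (r⁻¹ • (x - a)) := fun x => by
    simp only [dilate_apply a hr.ne', smul_smul, mul_inv_cancel₀ hr.ne', one_smul,
      add_sub_cancel]
  simp_rw [h1]
  rw [integral_sub_right_eq_self (fun x => (fun z => P (a + r • z) (φ z)) (r⁻¹ • x)) a,
    Measure.integral_comp_inv_smul_of_nonneg volume (fun z => P (a + r • z) (φ z)) hr.le]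
  simp

theorem ofFun_sub {P Q : Rn n → StrongDual ℝ Y} (hP : Continuous P) (hQ : Continuous Q)
    (φ : Test n Y) : ofFun (fun x => P x - Q x) φ = ofFun P φ - ofFun Q φ := by
  rw [ofFun_apply hP, ofFun_apply hQ, ofFun_apply (P := fun x => P x - Q x) (hP.sub hQ), ← integral_sub]
  · rfl
  · exact (hP.clm_apply φ.continuous).integrable_of_hasCompactSupport
      (φ.hasCompactSupport.mono fun x hx h => hx (by simp [h]))
  · exact (hQ.clm_apply φ.continuous).integrable_of_hasCompactSupport
      (φ.hasCompactSupport.mono fun x hx h => hx (by simp [h]))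

theorem abs_ofFun_dilate_le {P : Rn n → StrongDual ℝ Y} (hP : Continuous P) (a : Rn n) {r B : ℝ}
    (hr : 0 < r) (φ : Test n Y) (hB : ∀ x ∈ tsupport φ, ‖P (a + r • x)‖ ≤ B) :
    |ofFun P (dilate a r φ)| ≤ r ^ n * (B * ∫ x, ‖φ x‖) := by
  rw [ofFun_dilate hP a hr, abs_mul, abs_of_nonneg (by positivity : (0 : ℝ) ≤ r ^ n)]
  refine mul_le_mul_of_nonneg_left ?_ (by positivity)
  rw [← integral_const_mul]
  refine norm_integral_le_of_norm_le (f := fun x => P (a + r • x) (φ x)) ?_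
    (Eventually.of_forall fun x => ?_)
  · exact ((φ.continuous.norm).integrable_of_hasCompactSupport φ.hasCompactSupport.norm).const_mul _
  · by_cases hx : x ∈ tsupport φ
    · exact ((P (a + r • x)).le_opNorm _).trans
        (mul_le_mul_of_nonneg_right (hB x hx) (norm_nonneg _))
    · simp [image_eq_zero_of_notMem_tsupport hx]

/-- The value of a distribution at `φ_{a,r}` depends continuously on `a`. -/
theorem continuous_apply_dilate (T : Distrib n Y) {r : ℝ} (hr : 0 < r) (φ : Test n Y) :
    Continuous fun a => T (dilate a r φ) := by
  rw [continuous_iff_continuousAt]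
  intro a₀
  obtain ⟨ρ, hρ⟩ := φ.hasCompactSupport.isCompact.isBounded.subset_closedBall (0 : Rn n)
  obtain ⟨l, C, hC0, hC⟩ := exists_order_bound T ⟨Metric.closedBall a₀ (r * ρ + 1),
    isCompact_closedBall _ _⟩
  have hsub : ∀ a, dist a a₀ ≤ 1 →
      tsupport (dilate a r φ) ⊆ Metric.closedBall a₀ (r * ρ + 1) := fun a ha =>
    (tsupport_dilate_subset hρ a hr).trans (Metric.closedBall_subset_closedBall' (by linarith))
  rw [ContinuousAt, tendsto_iff_norm_sub_tendsto_zero]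
  rw [← tendsto_zero_iff_norm_tendsto_zero, Metric.tendsto_nhds]
  intro ε hε
  set ε' := ε / (C + 1) with hε'
  have hε'0 : 0 < ε' := by positivity
  -- The derivatives for different centres are translates of one uniformly continuous function, and
  -- only the orders up to `l` matter.
  have h1 : ∀ᶠ a in 𝓝 a₀, ∀ i ∈ Finset.range (l + 1), ∀ x,
      ‖iteratedFDeriv ℝ i (dilate a r φ) x - iteratedFDeriv ℝ i (dilate a₀ r φ) x‖ ≤ ε' := by
    rw [eventually_all_finset]
    intro i _
    set g := iteratedFDeriv ℝ i (dilate 0 r φ) with hg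
    have hgc : UniformContinuous g := by
      refine ((dilate 0 r φ).hasCompactSupport.iteratedFDeriv i).uniformContinuous_of_continuous ?_
      exact (dilate 0 r φ).contDiff.continuous_iteratedFDeriv (by exact_mod_cast le_top)
    obtain ⟨δ, hδ, hδg⟩ := Metric.uniformContinuous_iff.1 hgc ε' hε'0
    filter_upwards [Metric.ball_mem_nhds a₀ hδ] with a ha x
    have h2 : ∀ b, iteratedFDeriv ℝ i (dilate b r φ) x = g (x - b) := fun b => by
      rw [hg, iteratedFDeriv_dilate b hr.ne', iteratedFDeriv_dilate 0 hr.ne', sub_zero]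
    rw [h2, h2, ← dist_eq_norm]
    refine (hδg ?_).le
    rwa [dist_sub_left]
  filter_upwards [h1, Metric.closedBall_mem_nhds a₀ one_pos] with a ha ha1
  have h3 : T (dilate a r φ) - T (dilate a₀ r φ) = T (dilate a r φ - dilate a₀ r φ) :=
    (map_sub T _ _).symm
  rw [h3, dist_zero_right, Real.norm_eq_abs]
  have h4 : ((dilate a r φ - dilate a₀ r φ : Test n Y) : Rn n → Y) =
      (dilate a r φ : Rn n → Y) - dilate a₀ r φ := by ext x; simp
  refine (hC _ ?_ ε' fun i hi x => ?_).trans_lt ?_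
  · rw [h4]
    exact (tsupport_sub _ _).trans (union_subset (hsub a ha1) (hsub a₀ (by simp)))
  · rw [h4, iteratedFDeriv_sub_apply
      (((dilate a r φ).contDiff.of_le (by exact_mod_cast le_top)).contDiffAt)
      (((dilate a₀ r φ).contDiff.of_le (by exact_mod_cast le_top)).contDiffAt)]
    exact ha i (Finset.mem_range.2 (by omega)) x
  · rw [hε', mul_div_assoc', div_lt_iff₀ (by positivity)]
    nlinarith

end TestFunctions

/-! ### Baire category in the space of test functions with fixed compact support. -/

section UniformBoundedness

variable {n : ℕ} {Y : Type*} [NormedAddCommGroup Y] [NormedSpace ℝ Y]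

set_option synthInstance.maxHeartbeats 400000 in
open ContDiffMapSupportedIn in
-- If all derivatives converge uniformly, differentiation passes to the limit, so the limits `G i`
-- are the derivatives of `G 0`. The target is a countable product of complete metric spaces, whence
-- complete metrizability and the Baire property.
theorem isClosedEmbedding_pi_structureMapCLM [CompleteSpace Y] (K : Compacts (Rn n)) :
    IsClosedEmbedding (ContinuousLinearMap.pi (structureMapCLM ℝ (⊤ : ℕ∞)) :
      𝓓_{K}(Rn n, Y) →L[ℝ] Π i, BoundedContinuousFunction (Rn n) (Rn n [×i]→L[ℝ] Y)) := by
  refine ⟨(isUniformEmbedding_pi_structureMapCLM ℝ).isEmbedding, IsSeqClosed.isClosed ?_⟩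
  intro u G hu hG
  choose f hf using hu
  have huni : ∀ i, TendstoUniformly (fun m x => iteratedFDeriv ℝ i (f m) x) (fun x => G i x)
      atTop := by
    intro i
    have h1 : Tendsto (fun m => u m i) atTop (𝓝 (G i)) := (tendsto_pi_nhds.1 hG) i
    have h2 := BoundedContinuousFunction.tendsto_iff_tendstoUniformly.1 h1
    have h3 : (fun m x => iteratedFDeriv ℝ i (f m) x) = fun m => (u m i : Rn n → _) := by
      ext m x : 2
      rw [← hf m]
      exact (congrFun (structureMapCLM_top_apply ℝ (f m)) x).symm
    rw [h3]
    exact h2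
  have hder : ∀ (i : ℕ) (x : Rn n), HasFDerivAt (fun y => G i y) (G (i + 1) x).curryLeft x := by
    intro i x
    refine hasFDerivAt_of_tendstoUniformly (l := atTop)
      (f := fun m y => iteratedFDeriv ℝ i (f m) y)
      (f' := fun m y => (iteratedFDeriv ℝ (i + 1) (f m) y).curryLeft)
      (g' := fun y => (G (i + 1) y).curryLeft) ?_ (fun m y => ?_) (fun y => ?_) x
    · exact (continuousMultilinearCurryLeftEquiv ℝ (fun _ : Fin (i + 1) => Rn n) Y).isometry.uniformContinuous.comp_tendstoUniformly
        (huni (i + 1))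
    · exact (f m).contDiff.ftaylorSeries.fderiv i (by exact_mod_cast WithTop.coe_lt_top i) y
    · exact (huni i).tendsto_at y
  set g : Rn n → Y := fun x => (G 0 x).curry0 with hg
  have hT : HasFTaylorSeriesUpTo (((⊤ : ℕ∞) : WithTop ℕ∞)) g (fun x i => G i x) :=
    (hasFTaylorSeriesUpTo_top_iff' le_rfl).2 ⟨fun x => rfl, fun m x => hder m x⟩
  have hgs : ContDiff ℝ ((⊤ : ℕ∞) : WithTop ℕ∞) g := ⟨_, hT⟩
  refine ⟨⟨g, hgs, fun x hx => ?_⟩, ?_⟩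
  · have h1 := (huni 0).tendsto_at x
    have h2 : ∀ m, iteratedFDeriv ℝ 0 (f m) x = 0 := fun m =>
      (f m).iteratedFDeriv_zero_on_compl hx
    simp only [h2] at h1
    have h3 : G 0 x = 0 := tendsto_nhds_unique h1 tendsto_const_nhds |>.symm ▸ rfl
    simp [hg, h3]
  · ext i x : 2
    have h1 := (hasFTaylorSeriesUpToOn_univ_iff.2 hT).eq_iteratedFDerivWithin_of_uniqueDiffOn
      (m := i) (by exact_mod_cast le_top) uniqueDiffOn_univ (mem_univ x)
    rw [iteratedFDerivWithin_univ] at h1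
    show structureMapCLM ℝ (⊤ : ℕ∞) i _ x = G i x
    rw [structureMapCLM_top_apply]
    exact h1.symm

theorem isCompletelyMetrizableSpace_boundedContinuousFunction (X F : Type*) [TopologicalSpace X]
    [NormedAddCommGroup F] [CompleteSpace F] :
    IsCompletelyMetrizableSpace (BoundedContinuousFunction X F) :=
  inferInstance

set_option synthInstance.maxHeartbeats 400000 in
open ContDiffMapSupportedIn in
instance baireSpace_contDiffMapSupportedIn [CompleteSpace Y] (K : Compacts (Rn n)) : BaireSpace 𝓓_{K}(Rn n, Y) := by
  have : ∀ i : ℕ, IsCompletelyMetrizableSpace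
      (BoundedContinuousFunction (Rn n) (Rn n [×i]→L[ℝ] Y)) :=
    fun i => isCompletelyMetrizableSpace_boundedContinuousFunction _ _
  have := (isClosedEmbedding_pi_structureMapCLM (Y := Y) K).IsCompletelyMetrizableSpace
  infer_instance

theorem abs_dilate_le_seminorm (T : Distrib n Y) (a : Rn n) {r : ℝ} (hr : 0 < r) (hr1 : r ≤ 1) :
    ∃ (l : ℕ) (C : ℝ), 0 ≤ C ∧ ∀ φ : Test n Y, tsupport φ ⊆ Metric.closedBall 0 1 →
      ∀ B, DerivLE l B φ → |T (dilate a r φ)| ≤ C * B := by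
  obtain ⟨l, C, hC0, hC⟩ := exists_order_bound T ⟨Metric.closedBall a (r * 1),
    isCompact_closedBall _ _⟩
  refine ⟨l, C * (r⁻¹) ^ l, by positivity, fun φ hφ B hB => ?_⟩
  rw [mul_assoc]
  exact hC _ (tsupport_dilate_subset hφ a hr) _ (hB.dilate a hr hr1)

/-- The functional `φ ↦ T (φ_{a,r})` on test functions with support in a fixed compact set. -/
noncomputable def dilateLM (T : Distrib n Y) (K : Compacts (Rn n)) (a : Rn n) (r : ℝ) :
    𝓓_{K}(Rn n, Y) →ₗ[ℝ] ℝ where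
  toFun φ := T (dilate a r (TestFunction.ofSupportedIn (Ω := ⊤) (fun _ _ => trivial) φ))
  map_add' φ ψ := by
    rw [← map_add, ← dilate_add]; rfl
  map_smul' c φ := by
    rw [RingHom.id_apply, ← map_smul, ← dilate_smul]; rfl

theorem continuous_dilateLM (T : Distrib n Y) {K : Compacts (Rn n)}
    (hK : (K : Set (Rn n)) ⊆ Metric.closedBall 0 1) (a : Rn n) {r : ℝ} (hr : 0 < r) (hr1 : r ≤ 1) :
    Continuous (dilateLM T K a r) := by
  obtain ⟨l, C, hC0, hC⟩ := abs_dilate_le_seminorm T a hr hr1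
  refine WithSeminorms.continuous_normedSpace_rng ℝ
    (ContDiffMapSupportedIn.withSeminorms ℝ (Rn n) Y ⊤ K) _
    ⟨Finset.range (l + 1), ⟨C, hC0⟩, fun φ => ?_⟩
  refine hC _ (φ.tsupport_subset.trans hK) _ fun i hi x => ?_
  refine (ContDiffMapSupportedIn.norm_iteratedFDeriv_apply_le_seminorm_top ℝ).trans ?_
  exact Seminorm.le_finset_sup_apply (p := ContDiffMapSupportedIn.seminorm ℝ (Rn n) Y ⊤ K)
    (Finset.mem_range.2 (by omega))

/-- The uniform boundedness principle for the functionals `φ ↦ r⁻ᵉ T (φ_{a,r})`. -/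
theorem exists_uniform_bound [CompleteSpace Y] (T : Distrib n Y) (a : Rn n) (e : ℝ)
    (h : ∀ φ : Test n Y,
      limsup (fun r : ℝ => ((r ^ (-e) * T (dilate a r φ) : ℝ) : EReal)) (𝓝[>] 0) < ⊤) :
    ∃ (l : ℕ) (M δ : ℝ), 0 ≤ M ∧ 0 < δ ∧ ∀ φ : Test n Y, tsupport φ ⊆ Metric.closedBall 0 1 →
      ∀ B, DerivLE l B φ → ∀ r, 0 < r → r ≤ δ → |T (dilate a r φ)| ≤ M * B * r ^ e := by
  set K : Compacts (Rn n) := ⟨Metric.closedBall 0 1, isCompact_closedBall _ _⟩ with hK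
  have hKle : (K : Set (Rn n)) ⊆ Metric.closedBall 0 1 := le_rfl
  have hev : ∀ φ : Test n Y, ∃ c : ℝ, ∀ᶠ r in 𝓝[>] (0 : ℝ), r ^ (-e) * T (dilate a r φ) < c := by
    intro φ
    obtain ⟨c, hc, -⟩ := EReal.lt_iff_exists_real_btwn.1 (h φ)
    refine ⟨c, (eventually_lt_of_limsup_lt hc).mono fun r hr => ?_⟩
    exact_mod_cast hr
  set δ : ℕ → ℝ := fun j => 1 / ((j : ℝ) + 1) with hδ
  have hδ0 : ∀ j, 0 < δ j := fun j => by positivity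
  have hδ1 : ∀ j, δ j ≤ 1 := fun j => by
    rw [hδ, div_le_one (by positivity)]
    linarith [(Nat.cast_nonneg j : (0 : ℝ) ≤ j)]
  set S : ℕ → Set 𝓓_{K}(Rn n, Y) := fun j => {φ | ∀ r, 0 < r → r ≤ δ j →
    |dilateLM T K a r φ| ≤ j * r ^ e} with hS
  have hSc : ∀ j, IsClosed (S j) := by
    intro j
    simp only [hS, ofPred_forall]
    refine isClosed_iInter fun r => isClosed_iInter fun hr => isClosed_iInter fun hrj => ?_
    exact isClosed_le (continuous_abs.comp
      (continuous_dilateLM T hKle a hr (hrj.trans (hδ1 j)))) continuous_const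
  have hSu : ⋃ j, S j = univ := by
    refine eq_univ_of_forall fun φ => mem_iUnion.2 ?_
    set ψ : Test n Y := TestFunction.ofSupportedIn (Ω := ⊤) (fun _ _ => trivial) φ with hψ
    obtain ⟨c, hc⟩ := hev ψ
    -- The hypothesis bounds only from above; applying it to `-ψ` gives the bound from below.
    obtain ⟨c', hc'⟩ := hev ((-1 : ℝ) • ψ)
    obtain ⟨ε, hε, hεs⟩ := mem_nhdsGT_iff_exists_Ioo_subset.1 (hc.and hc')
    obtain ⟨j, hj⟩ := exists_nat_gt (max (max c c') (1 / ε))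
    refine ⟨j, fun r hr hrj => ?_⟩
    have hrε : r < ε := by
      refine hrj.trans_lt ?_
      rw [hδ, div_lt_iff₀ (by positivity)]
      have h1 := (le_max_right _ _).trans_lt hj
      rw [div_lt_iff₀ hε] at h1
      nlinarith [mem_Ioi.1 hε]
    obtain ⟨h1, h2⟩ := hεs ⟨hr, hrε⟩
    rw [dilate_smul, map_smul, smul_eq_mul] at h2
    have h3 : c < j := ((le_max_left _ _).trans (le_max_left _ _)).trans_lt hj
    have h4 : c' < j := ((le_max_right _ _).trans (le_max_left _ _)).trans_lt hj
    show |T (dilate a r ψ)| ≤ _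
    have h5 : |r ^ (-e) * T (dilate a r ψ)| ≤ j := by
      rw [abs_le]; constructor <;> linarith
    rw [abs_mul, abs_of_nonneg (Real.rpow_nonneg hr.le _), Real.rpow_neg hr.le,
      inv_mul_le_iff₀ (Real.rpow_pos_of_pos hr e)] at h5
    rwa [mul_comm]
  obtain ⟨j, φ₀, hφ₀⟩ := nonempty_interior_of_iUnion_of_closed hSc hSu
  obtain ⟨s, ε, hε, hball⟩ := ((ContDiffMapSupportedIn.withSeminorms ℝ (Rn n) Y ⊤ K).mem_nhds_iff
    φ₀ _).1 (mem_interior_iff_mem_nhds.1 hφ₀)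
  have hφ₀S : φ₀ ∈ S j := interior_subset hφ₀
  refine ⟨s.sup id, 4 * j / ε, δ j, by positivity, hδ0 j, fun φ hφ B hB r hr hrj => ?_⟩
  have hpos : ∀ B' > 0, B ≤ B' → |T (dilate a r φ)| ≤ 4 * j / ε * B' * r ^ e := by
    intro B' hB' hBB
    set ψ := toSupportedIn K φ hφ with hψ
    -- Makes `φ₀ + t ψ` lie in the seminorm ball inside `S j`. Then `t T(ψ_{a,r})` is a difference
    -- of two values bounded by `j r^e`, and `2j / t = 4j B' / ε`.
    set t : ℝ := ε / (2 * B') with ht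
    have ht0 : 0 < t := by positivity
    have h1 : φ₀ + t • ψ ∈ S j := by
      refine hball ?_
      rw [Seminorm.mem_ball, add_sub_cancel_left, map_smul_eq_mul, Real.norm_of_nonneg ht0.le]
      have h2 : (s.sup (ContDiffMapSupportedIn.seminorm ℝ (Rn n) Y ⊤ K)) ψ ≤ B' :=
        Seminorm.finset_sup_apply_le hB'.le fun i hi =>
          (seminorm_toSupportedIn_le hφ hB (Finset.le_sup (f := id) hi)).trans hBB
      calc t * (s.sup (ContDiffMapSupportedIn.seminorm ℝ (Rn n) Y ⊤ K)) ψ ≤ t * B' :=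
            mul_le_mul_of_nonneg_left h2 ht0.le
        _ = ε / 2 := by rw [ht]; field_simp
        _ < ε := by linarith
    have h2 := h1 r hr hrj
    have h3 := hφ₀S r hr hrj
    rw [map_add, map_smul, smul_eq_mul] at h2
    have h4 : |t * dilateLM T K a r ψ| ≤ 2 * (j * r ^ e) := by
      have := abs_sub (dilateLM T K a r φ₀ + t * dilateLM T K a r ψ) (dilateLM T K a r φ₀)
      rw [add_sub_cancel_left] at this
      linarith
    rw [abs_mul, abs_of_pos ht0, ← le_div_iff₀' ht0] at h4
    refine h4.trans (le_of_eq ?_)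
    rw [ht]; field_simp; ring
  -- For `B = 0` the factor `t` is unusable, but then `φ = 0`.
  rcases hB.nonneg.eq_or_lt with h0 | h0
  · have h1 : φ = 0 := by
      ext x
      have := hB 0 (Nat.zero_le _) x
      rw [norm_iteratedFDeriv_zero, ← h0] at this
      simpa using this
    have h2 : dilate a r (0 : Test n Y) = 0 := by
      have := dilate_smul a r 0 (0 : Test n Y)
      simpa using this
    rw [h1, h2, map_zero, abs_zero, ← h0]
    simp
  · exact hpos B h0 le_rfl

end UniformBoundedness

/-! ### A compactly supported kernel reproducing polynomials. -/

section Kernel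

/-- The standard smooth bump function on `ℝⁿ` with integral one and support in the unit ball. -/
noncomputable def unitBump (n : ℕ) : Rn n → ℝ :=
  (⟨1 / 2, 1, by norm_num, by norm_num⟩ : ContDiffBump (0 : Rn n)).normed volume

theorem contDiff_unitBump (n : ℕ) : ContDiff ℝ ((⊤ : ℕ∞) : WithTop ℕ∞) (unitBump n) :=
  ContDiffBump.contDiff_normed _

theorem integral_unitBump (n : ℕ) : ∫ z, unitBump n z = 1 :=
  ContDiffBump.integral_normed _

theorem tsupport_unitBump (n : ℕ) : tsupport (unitBump n) = Metric.closedBall 0 1 :=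
  ContDiffBump.tsupport_normed_eq _

theorem hasCompactSupport_unitBump (n : ℕ) : HasCompactSupport (unitBump n) :=
  ContDiffBump.hasCompactSupport_normed _

/-- A smooth kernel supported in the unit ball which reproduces polynomials of degree less
than `N`. -/
noncomputable def reproKernel (n N : ℕ) (z : Rn n) : ℝ :=
  ∑ i ∈ Finset.range (N + 1), coeffWeight (N + 1) 0 i *
    (((((i : ℝ) + 1) / (N + 1 : ℕ))⁻¹) ^ n * unitBump n (((((i : ℝ) + 1) / (N + 1 : ℕ))⁻¹) • z))

theorem contDiff_reproKernel (n N : ℕ) :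
    ContDiff ℝ ((⊤ : ℕ∞) : WithTop ℕ∞) (reproKernel n N) :=
  ContDiff.sum fun _ _ => contDiff_const.mul
    (contDiff_const.mul ((contDiff_unitBump n).comp (contDiff_id.const_smul _)))

theorem tsupport_reproKernel_subset (n N : ℕ) :
    tsupport (reproKernel n N) ⊆ Metric.closedBall 0 1 := by
  refine closure_minimal (fun z hz => ?_) Metric.isClosed_closedBall
  by_contra hz1
  refine hz (Finset.sum_eq_zero fun i hi => ?_)
  obtain ⟨h0, h1⟩ := node_mem (Finset.mem_range.1 hi)
  rw [image_eq_zero_of_notMem_tsupport (f := unitBump n), mul_zero, mul_zero]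
  rw [tsupport_unitBump]
  intro h
  refine hz1 ?_
  rw [mem_closedBall_zero_iff] at h ⊢
  rw [norm_smul, Real.norm_of_nonneg (inv_nonneg.2 h0.le), inv_mul_le_iff₀ h0] at h
  linarith

theorem hasCompactSupport_reproKernel (n N : ℕ) : HasCompactSupport (reproKernel n N) :=
  (isCompact_closedBall (0 : Rn n) 1).of_isClosed_subset (isClosed_tsupport _)
    (tsupport_reproKernel_subset n N)

/-- Rescaling each dilated bump moves the dilation onto `g`; the weighted sum of the values `g (c
z)` over the nodes `c` is then the constant `g 0`, and the bump has integral one. -/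
theorem integral_reproKernel_mul {n N : ℕ} {g : Rn n → ℝ} (hg : IsPolyLT N g) :
    ∫ z, reproKernel n N z * g z = g 0 := by
  have hgc : Continuous g := (hg.contDiff (m := 0)).continuous
  have hint : ∀ c : ℝ, Integrable fun z => unitBump n z * g (c • z) := fun c =>
    ((contDiff_unitBump n).continuous.mul (hgc.comp (continuous_const_smul c))).integrable_of_hasCompactSupport
      (hasCompactSupport_unitBump n).mul_right
  have h1 : ∀ i ∈ Finset.range (N + 1),
      (Integrable fun z => coeffWeight (N + 1) 0 i *
        (((((i : ℝ) + 1) / (N + 1 : ℕ))⁻¹) ^ n *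
          unitBump n (((((i : ℝ) + 1) / (N + 1 : ℕ))⁻¹) • z)) * g z) ∧
      ∫ z, coeffWeight (N + 1) 0 i *
        (((((i : ℝ) + 1) / (N + 1 : ℕ))⁻¹) ^ n *
          unitBump n (((((i : ℝ) + 1) / (N + 1 : ℕ))⁻¹) • z)) * g z =
      ∫ z, coeffWeight (N + 1) 0 i * (unitBump n z * g ((((i : ℝ) + 1) / (N + 1 : ℕ)) • z)) := by
    intro i hi
    have h0 := (node_mem (Finset.mem_range.1 hi)).1
    set c : ℝ := ((i : ℝ) + 1) / (N + 1 : ℕ) with hc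
    have h2 : ∀ z, coeffWeight (N + 1) 0 i * ((c⁻¹) ^ n * unitBump n (c⁻¹ • z)) * g z =
        coeffWeight (N + 1) 0 i * (c⁻¹) ^ n *
          (fun y => unitBump n y * g (c • y)) (c⁻¹ • z) := fun z => by
      simp only [smul_smul, mul_inv_cancel₀ h0.ne', one_smul]
      ring
    simp_rw [h2]
    refine ⟨((hint c).comp_smul (inv_ne_zero h0.ne')).const_mul _, ?_⟩
    rw [integral_const_mul, integral_const_mul,
      Measure.integral_comp_inv_smul_of_nonneg volume (fun y => unitBump n y * g (c • y)) h0.le]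
    simp only [finrank_euclideanSpace, Fintype.card_fin, smul_eq_mul]
    rw [mul_assoc, ← mul_assoc ((c⁻¹) ^ n), ← mul_pow, inv_mul_cancel₀ h0.ne', one_pow, one_mul]
  simp only [reproKernel, Finset.sum_mul]
  rw [integral_finsetSum _ fun i hi => (h1 i hi).1, Finset.sum_congr rfl fun i hi => (h1 i hi).2,
    ← integral_finsetSum _ fun i _ => (hint _).const_mul _]
  have h3 : ∀ z, ∑ i ∈ Finset.range (N + 1), coeffWeight (N + 1) 0 i *
      (unitBump n z * g ((((i : ℝ) + 1) / (N + 1 : ℕ)) • z)) = unitBump n z * g 0 := fun z => by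
    rw [hg.apply_eq 0 z, Finset.mul_sum]
    refine Finset.sum_congr rfl fun i _ => ?_
    rw [zero_add, smul_eq_mul]
    ring
  simp_rw [h3]
  rw [integral_mul_const, integral_unitBump, one_mul]

variable {n : ℕ} {Y : Type*} [NormedAddCommGroup Y] [NormedSpace ℝ Y]

/-- The test function `z ↦ η(z) y` with the reproducing kernel `η`. -/
noncomputable def reproTest (N : ℕ) (y : Y) : Test n Y :=
  ⟨fun z => reproKernel n N z • y, (contDiff_reproKernel n N).smul contDiff_const,
    (hasCompactSupport_reproKernel n N).smul_right, fun _ _ => trivial⟩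

theorem reproTest_apply (N : ℕ) (y : Y) (z : Rn n) :
    reproTest N y z = reproKernel n N z • y := rfl

theorem tsupport_reproTest_subset (N : ℕ) (y : Y) :
    tsupport (reproTest N y : Test n Y) ⊆ Metric.closedBall 0 1 :=
  (closure_mono fun z (hz : reproTest N y z ≠ 0) (h : reproKernel n N z = 0) =>
    hz (by rw [reproTest_apply, h, zero_smul])).trans (tsupport_reproKernel_subset n N)

theorem exists_derivLE_reproTest (n N l : ℕ) : ∃ C : ℝ, 0 ≤ C ∧
    ∀ {Y : Type*} [NormedAddCommGroup Y] [NormedSpace ℝ Y] (y : Y),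
      DerivLE l (C * ‖y‖) (reproTest N y : Test n Y) := by
  choose B hB0 hB using fun m : ℕ => exists_bound_iteratedFDeriv (m := m)
    ((contDiff_reproKernel n N).of_le (by exact_mod_cast le_top)) (hasCompactSupport_reproKernel n N)
  refine ⟨∑ i ∈ Finset.range (l + 1), B i, Finset.sum_nonneg fun i _ => hB0 i,
    fun {Y} _ _ y i hi x => ?_⟩
  have h1 := (ContinuousLinearMap.toSpanSingleton ℝ y).norm_iteratedFDeriv_comp_left
    (f := reproKernel n N) (x := x) (n := i)
    (contDiff_reproKernel n N).contDiffAt (by exact_mod_cast le_top)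
  rw [ContinuousLinearMap.norm_toSpanSingleton, mul_comm] at h1
  refine h1.trans (mul_le_mul_of_nonneg_right ((hB i x).trans ?_) (norm_nonneg _))
  exact Finset.single_le_sum (f := B) (fun i _ => hB0 i) (Finset.mem_range.2 (by omega))

theorem ofFun_dilate_reproTest {N : ℕ} {Q : Rn n → StrongDual ℝ Y} (hQ : IsPolyLT N Q) (x : Rn n)
    {r : ℝ} (hr : 0 < r) (y : Y) : ofFun Q (dilate x r (reproTest N y)) = r ^ n * Q x y := by
  rw [ofFun_dilate (hQ.contDiff (m := 0)).continuous x hr]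
  congr 1
  have h1 : ∀ z, Q (x + r • z) (reproTest N y z) =
      reproKernel n N z * Q (x + r • z) y := fun z => by
    rw [reproTest_apply, map_smul, smul_eq_mul]
  simp_rw [h1]
  have h2 : IsPolyLT N fun z => Q (x + r • z) y := by
    obtain ⟨p, hp⟩ := hQ.expansion x
    refine isPolyLT_of_sum (fun m => ((ContinuousLinearMap.apply ℝ ℝ y).compContinuousMultilinearMap
      (p m)).compContinuousLinearMap fun _ => r • ContinuousLinearMap.id ℝ (Rn n)) 0 fun z => ?_
    rw [HasFiniteFPowerSeriesOnBall.eq_sum hp]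
    simp
  rw [integral_reproKernel_mul h2, smul_zero, add_zero]

end Kernel

/-! ### Points of uniform approximation: compatibility, closedness, exhaustion. -/

section GoodPoints

variable {n : ℕ} {Y : Type*} [NormedAddCommGroup Y] [NormedSpace ℝ Y]

/-- The distribution `T` is approximated by `P` near `a` to order `s`, with uniform constants
given by `j`. -/
def IsApprox (T : Distrib n Y) (j : ℕ) (s : ℝ) (a : Rn n) (P : Rn n → StrongDual ℝ Y) : Prop :=
  ∀ φ : Test n Y, tsupport φ ⊆ Metric.closedBall 0 1 → ∀ B, DerivLE j B φ →
    ∀ r, 0 < r → r ≤ 1 / ((j : ℝ) + 1) →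
      |(T - ofFun P) (dilate a r φ)| ≤ j * B * r ^ (s + n)

/-- The points of the ball of radius `j` at which `T` has a polynomial approximation of order `s`
with uniform constants given by `j`. -/
def approxSet (T : Distrib n Y) (N : ℕ) (s : ℝ) (j : ℕ) : Set (Rn n) :=
  {a | ‖a‖ ≤ j ∧ ∃ P, IsPolyLT N P ∧ IsApprox T j s a P}

variable {T : Distrib n Y} {j : ℕ} {s : ℝ} {a b : Rn n} {P Q : Rn n → StrongDual ℝ Y}

/-- Shrinking `φ` into the unit ball is compensated by enlarging `r` by a constant factor. -/
theorem IsApprox.exists_eventually_le (h : IsApprox T j s a P) (φ : Test n Y) :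
    ∃ c, ∀ᶠ r in 𝓝[>] (0 : ℝ), |(T - ofFun P) (dilate a r φ)| ≤ c * r ^ (s + n) := by
  obtain ⟨R, hR1, hR⟩ := φ.hasCompactSupport.isCompact.isBounded.subset_closedBall_lt 0 (0 : Rn n)
  set ψ := dilate 0 R⁻¹ φ with hψ
  have hsupp : tsupport ψ ⊆ Metric.closedBall 0 1 := by
    have := tsupport_dilate_subset hR 0 (inv_pos.2 hR1)
    rwa [inv_mul_cancel₀ hR1.ne'] at this
  obtain ⟨B, hB⟩ := exists_derivLE j ψ
  refine ⟨j * B * R ^ (s + n), ?_⟩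
  have hδ : 0 < 1 / ((j : ℝ) + 1) / R := by positivity
  filter_upwards [Ioc_mem_nhdsGT hδ] with r hr
  have h1 : dilate a r φ = dilate a (r * R) ψ := by
    rw [hψ, dilate_dilate a 0 (mul_pos hr.1 hR1).ne' (inv_pos.2 hR1).ne', smul_zero, add_zero,
      mul_assoc, mul_inv_cancel₀ hR1.ne', mul_one]
  rw [h1]
  refine (h ψ hsupp B hB (r * R) (mul_pos hr.1 hR1) ((le_div_iff₀ hR1).1 hr.2)).trans (le_of_eq ?_)
  rw [Real.mul_rpow hr.1.le hR1.le]
  ring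

/-- Recentring: the ball of radius `r` about `x` lies in that of radius `3r` about `a`, so `φ_{x,r}`
is a dilate at `a` of scale `3r`. Compressing `φ` by `3` costs `3 ^ j` in the derivatives. -/
theorem IsApprox.abs_apply_dilate_le (h : IsApprox T j s a P) {x : Rn n} {r : ℝ} (hr : 0 < r)
    (hr1 : 3 * r ≤ 1 / ((j : ℝ) + 1)) (hx : ‖x - a‖ ≤ 2 * r) {φ : Test n Y}
    (hφ : tsupport φ ⊆ Metric.closedBall 0 1) {B : ℝ} (hB : DerivLE j B φ) :
    |(T - ofFun P) (dilate x r φ)| ≤ j * (3 ^ j * B) * (3 * r) ^ (s + n) := by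
  set c : Rn n := (3 * r)⁻¹ • (x - a) with hc
  have h3r : 0 < 3 * r := by positivity
  have h1 : dilate x r φ = dilate a (3 * r) (dilate c 3⁻¹ φ) := by
    rw [dilate_dilate a c h3r.ne' (by norm_num), hc, smul_smul, mul_inv_cancel₀ h3r.ne', one_smul,
      add_sub_cancel]
    congr 1
    ring
  have hc1 : ‖c‖ ≤ 2 / 3 := by
    rw [hc, norm_smul, Real.norm_of_nonneg (by positivity), inv_mul_le_iff₀ h3r]
    linarith
  rw [h1]
  refine h _ ((tsupport_dilate_subset hφ c (by norm_num)).trans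
    (Metric.closedBall_subset_closedBall' ?_)) _ ?_ _ h3r hr1
  · rw [dist_zero_right]; linarith
  · have := hB.dilate c (r := 3⁻¹) (by norm_num) (by norm_num)
    rwa [inv_inv] at this

/-- Tested with the reproducing kernel at `x`, the distribution `S_P - S_Q` gives exactly `r^n (P x
- Q x)`; it is also the difference of two errors of size `r^(s+n)`, since `T` cancels. -/
theorem exists_norm_sub_le_of_isApprox (n N j : ℕ) (s : ℝ) : ∃ M : ℝ, 0 ≤ M ∧
    ∀ {Y : Type*} [NormedAddCommGroup Y] [NormedSpace ℝ Y] (T : Distrib n Y)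
      {P Q : Rn n → StrongDual ℝ Y} (_ : IsPolyLT N P) (_ : IsPolyLT N Q) {a b x : Rn n}
      (_ : IsApprox T j s a P) (_ : IsApprox T j s b Q) {r : ℝ} (_ : 0 < r)
      (_ : 3 * r ≤ 1 / ((j : ℝ) + 1)) (_ : ‖x - a‖ ≤ 2 * r) (_ : ‖x - b‖ ≤ 2 * r),
      ‖P x - Q x‖ ≤ M * r ^ s := by
  obtain ⟨C, hC0, hC⟩ := exists_derivLE_reproTest n N j
  refine ⟨2 * (j * 3 ^ j * C * 3 ^ (s + n)), by positivity, ?_⟩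
  intro Y _ _ T P Q hP hQ a b x ha hb r hr hr1 hxa hxb
  refine ContinuousLinearMap.opNorm_le_bound _ (by positivity) fun y => ?_
  have h1 := ofFun_dilate_reproTest (hP.sub hQ) x hr y
  rw [ofFun_sub (hP.contDiff (m := 0)).continuous (hQ.contDiff (m := 0)).continuous] at h1
  have h2 := ha.abs_apply_dilate_le hr hr1 hxa (tsupport_reproTest_subset N y) (hC y)
  have h3 := hb.abs_apply_dilate_le hr hr1 hxb (tsupport_reproTest_subset N y) (hC y)
  rw [sub_apply] at h2 h3
  have h4 : (3 * r) ^ (s + n) = 3 ^ (s + n) * (r ^ s * r ^ n) := by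
    rw [Real.mul_rpow (by norm_num) hr.le, Real.rpow_add hr, Real.rpow_natCast]
  rw [h4, abs_le] at h2 h3
  have h5 : r ^ n * |(P x - Q x) y| ≤
      r ^ n * (2 * (j * 3 ^ j * C * 3 ^ (s + n)) * r ^ s * ‖y‖) := by
    rw [← abs_of_pos (pow_pos hr n), ← abs_mul, ← h1, abs_of_pos (pow_pos hr n), abs_le]
    constructor <;> nlinarith [h2.1, h2.2, h3.1, h3.2]
  exact le_of_mul_le_mul_left h5 (pow_pos hr n)

/-- Taylor's formula at `z` with Markov's inequality: degrees are at most `N - 1`, so passing from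
radius `r` to `R` loses at most `r^(1-N)`. -/
theorem IsPolyLT.exists_norm_le_of_ball (N : ℕ) {R : ℝ} (hR : 0 ≤ R) : ∃ K : ℝ, 0 ≤ K ∧
    ∀ {E : Type} [NormedAddCommGroup E] [NormedSpace ℝ E] {F : Type*} [NormedAddCommGroup F]
      [NormedSpace ℝ F] [CompleteSpace F] {Q : E → F} (_ : IsPolyLT N Q) (z : E) {r B : ℝ}
      (_ : 0 < r) (_ : r ≤ 1) (_ : ∀ x, ‖x - z‖ ≤ r → ‖Q x‖ ≤ B),
      ∀ x, ‖x - z‖ ≤ R → ‖Q x‖ ≤ K * r ^ (1 - N : ℝ) * B := by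
  refine ⟨∑ m ∈ Finset.range N, (markovConst N * (m + 1)) ^ m * R ^ m, ?_, ?_⟩
  · have := markovConst_nonneg N
    exact Finset.sum_nonneg fun m _ => by positivity
  intro E _ _ F _ _ _ Q hQ z r B hr hr1 hB x hx
  have hB0 : 0 ≤ B := (norm_nonneg _).trans (hB z (by simpa using hr.le))
  have hm0 := markovConst_nonneg N
  rw [hQ.taylor z x, Finset.sum_mul, Finset.sum_mul]
  refine norm_sum_le_of_le _ fun m hm => ?_
  refine (ContinuousMultilinearMap.le_opNorm _ _).trans ?_
  rw [Finset.prod_const, Finset.card_univ, Fintype.card_fin]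
  have h1 : ‖((m.factorial : ℝ)⁻¹ • iteratedFDeriv ℝ m Q z)‖ ≤
      (markovConst N * (m + 1)) ^ m * (r⁻¹) ^ m * B := by
    rw [norm_smul, Real.norm_of_nonneg (by positivity)]
    refine (mul_le_of_le_one_left (norm_nonneg _) (inv_le_one_of_one_le₀ ?_)).trans
      (hQ.norm_iteratedFDeriv_le m z hr hB)
    exact_mod_cast m.factorial_pos
  have h2 : (r⁻¹) ^ m ≤ r ^ (1 - N : ℝ) := by
    rw [inv_pow, ← Real.rpow_natCast, ← Real.rpow_neg hr.le]
    refine Real.rpow_le_rpow_of_exponent_ge hr hr1 ?_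
    have : (m : ℝ) + 1 ≤ N := by exact_mod_cast Finset.mem_range.1 hm
    linarith
  calc _ ≤ (markovConst N * (m + 1)) ^ m * (r ^ (1 - N : ℝ)) * B * R ^ m := by
        gcongr
        exact h1.trans (by gcongr)
    _ = _ := by ring

theorem isWhitneyField_of_isApprox (T : Distrib n Y) (k j : ℕ) (s : ℝ)
    (P : Rn n → Rn n → StrongDual ℝ Y) (S : Set (Rn n)) (hP : ∀ a ∈ S, IsPolyLT (k + 1) (P a))
    (hS : ∀ a ∈ S, IsApprox T j s a (P a)) :
    ∃ M r₀, IsWhitneyField S k s P M r₀ := by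
  obtain ⟨M, hM0, hM⟩ := exists_norm_sub_le_of_isApprox n (k + 1) j s
  refine ⟨M, 1 / ((j : ℝ) + 1) / 3, hP, hM0, by positivity, fun a ha b hb r hr hr1 hab x hx => ?_⟩
  refine hM T (hP b hb) (hP a ha) (hS b hb) (hS a ha) hr (by linarith) ?_ (by linarith)
  calc ‖x - b‖ ≤ ‖x - a‖ + ‖a - b‖ := norm_sub_le_norm_sub_add_norm_sub _ _ _
    _ ≤ 2 * r := by linarith

/-- Approximating polynomials at points of a Cauchy sequence form a Cauchy sequence. -/
theorem exists_norm_sub_le_of_cauchySeq {N : ℕ} (hs : (N : ℝ) - 1 < s) {u : ℕ → Rn n}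
    (hu : CauchySeq u) {P : ℕ → Rn n → StrongDual ℝ Y} (hP : ∀ i, IsPolyLT N (P i))
    (hA : ∀ i, IsApprox T j s (u i) (P i)) {R : ℝ} (hR : 0 ≤ R) {ε : ℝ} (hε : 0 < ε) :
    ∃ i₀, ∀ i ≥ i₀, ∀ l ≥ i₀, ∀ x, ‖x - u i‖ ≤ R → ‖P i x - P l x‖ ≤ ε := by
  obtain ⟨M, hM0, hM⟩ := exists_norm_sub_le_of_isApprox n N j s
  obtain ⟨K, hK0, hK⟩ := IsPolyLT.exists_norm_le_of_ball N hR
  -- The loss `r^(1-N)` is beaten by the gain `r^s` because `s > N - 1`. The radius is fixed first,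
  -- the index afterwards.
  have ht : Tendsto (fun r : ℝ => K * M * r ^ (s - (N - 1))) (𝓝[>] 0) (𝓝 0) := by
    have h1 : Tendsto (fun r : ℝ => r ^ (s - (N - 1))) (𝓝[>] 0) (𝓝 0) := by
      have := (Real.continuousAt_rpow_const 0 (s - (N - 1)) (Or.inr (by linarith))).tendsto
      rw [Real.zero_rpow (by linarith)] at this
      exact this.mono_left nhdsWithin_le_nhds
    simpa using h1.const_mul (K * M)
  have hδ : 0 < 1 / ((j : ℝ) + 1) / 3 := by positivity
  obtain ⟨r, hr, hrε⟩ := ((show ∀ᶠ r in 𝓝[>] (0 : ℝ), r ∈ Ioc 0 _ from Ioc_mem_nhdsGT hδ).and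
    (ht.eventually (gt_mem_nhds hε))).exists
  have hr1 : r ≤ 1 := by
    have : 1 / ((j : ℝ) + 1) ≤ 1 := by
      rw [div_le_one (by positivity)]; linarith [(Nat.cast_nonneg j : (0 : ℝ) ≤ j)]
    linarith [hr.2]
  obtain ⟨i₀, hi₀⟩ := Metric.cauchySeq_iff.1 hu r hr.1
  refine ⟨i₀, fun i hi l hl x hx => ?_⟩
  have hil := (hi₀ i hi l hl).le
  rw [dist_eq_norm] at hil
  have h1 := hK ((hP i).sub (hP l)) (u i) hr.1 hr1 (B := M * r ^ s) (fun z hz => ?_) x hx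
  · refine h1.trans (le_trans (le_of_eq ?_) hrε.le)
    rw [sub_sub_eq_add_sub, add_sub_assoc, Real.rpow_add hr.1]
    ring
  · refine hM T (hP i) (hP l) (hA i) (hA l) hr.1 (by linarith [hr.2]) (by linarith [hr.1]) ?_
    calc ‖z - u l‖ ≤ ‖z - u i‖ + ‖u i - u l‖ := norm_sub_le_norm_sub_add_norm_sub _ _ _
      _ ≤ 2 * r := by linarith

/-- Limits of polynomials of bounded degree, uniform on the unit ball, are polynomials. -/
theorem exists_isPolyLT_tendsto {E : Type} [NormedAddCommGroup E] [NormedSpace ℝ E]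
    {F : Type*} [NormedAddCommGroup F] [NormedSpace ℝ F] [CompleteSpace F] {N : ℕ}
    {P : ℕ → E → F} (hP : ∀ i, IsPolyLT N (P i))
    (hc : ∀ ε > 0, ∃ i₀, ∀ i ≥ i₀, ∀ l ≥ i₀, ∀ x, ‖x‖ ≤ 1 → ‖P i x - P l x‖ ≤ ε) :
    ∃ P₀, IsPolyLT N P₀ ∧ ∀ x, Tendsto (fun i => P i x) atTop (𝓝 (P₀ x)) := by
  have h1 : ∀ m, CauchySeq fun i => iteratedFDeriv ℝ m (P i) 0 := by
    intro m
    set κ := (markovConst N * (m + 1)) ^ m with hκ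
    have hκ0 : 0 ≤ κ := by have := markovConst_nonneg N; positivity
    refine Metric.cauchySeq_iff.2 fun ε hε => ?_
    obtain ⟨i₀, hi₀⟩ := hc (ε / (κ + 1)) (by positivity)
    refine ⟨i₀, fun i hi l hl => ?_⟩
    have h2 := ((hP i).sub (hP l)).norm_iteratedFDeriv_le m 0 one_pos
      (fun z hz => hi₀ i hi l hl z (by simpa using hz))
    have h3 : (fun x => P i x - P l x) = P i - P l := rfl
    rw [h3, iteratedFDeriv_sub_apply (hP i).contDiff.contDiffAt (hP l).contDiff.contDiffAt,
      inv_one, one_pow, mul_one] at h2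
    rw [dist_eq_norm]
    refine h2.trans_lt ?_
    rw [mul_div_assoc', div_lt_iff₀ (by positivity)]
    nlinarith
  choose q hq using fun m => cauchySeq_tendsto_of_complete (h1 m)
  refine ⟨fun x => ∑ m ∈ Finset.range N, ((m.factorial : ℝ)⁻¹ • q m) (fun _ => x - 0),
    isPolyLT_of_sum _ 0 fun x => rfl, fun x => ?_⟩
  simp_rw [fun i => (hP i).taylor 0 x]
  refine tendsto_finsetSum _ fun m _ => ?_
  have h4 : Continuous fun p : ContinuousMultilinearMap ℝ (fun _ : Fin m => E) F =>
      ((m.factorial : ℝ)⁻¹ • p) (fun _ => x - 0) := by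
    simp only [smul_apply]
    exact (continuous_eval_const _).const_smul _
  exact (h4.tendsto _).comp (hq m)

theorem isClosed_approxSet (T : Distrib n Y) {N : ℕ} (hs : (N : ℝ) - 1 < s) (j : ℕ) :
    IsClosed (approxSet T N s j) := by
  refine IsSeqClosed.isClosed fun u a hu hua => ?_
  choose hnorm P hP hA using hu
  have hcau := fun {R : ℝ} (hR : 0 ≤ R) {ε : ℝ} (hε : 0 < ε) =>
    exists_norm_sub_le_of_cauchySeq hs hua.cauchySeq hP hA hR hε
  obtain ⟨P₀, hP₀, hlim⟩ := exists_isPolyLT_tendsto hP fun ε hε => by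
    obtain ⟨i₀, hi₀⟩ := hcau (R := j + 1) (by positivity) hε
    refine ⟨i₀, fun i hi l hl x hx => hi₀ i hi l hl x ?_⟩
    linarith [norm_sub_le x (u i), hnorm i]
  refine ⟨le_of_tendsto' hua.norm hnorm, P₀, hP₀, fun φ hφ B hB r hr hr1 => ?_⟩
  have hc₀ := (hP₀.contDiff (m := 0)).continuous
  have hci := fun i => ((hP i).contDiff (m := 0)).continuous
  have ht1 : Tendsto (fun i => (T - ofFun P₀) (dilate (u i) r φ)) atTop
      (𝓝 ((T - ofFun P₀) (dilate a r φ))) :=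
    ((continuous_apply_dilate _ hr φ).tendsto a).comp hua
  -- Centre and polynomial both vary with `i`; this term absorbs the change of polynomial, `ht1`
  -- that of centre.
  have ht2 : Tendsto (fun i => ofFun (fun x => P i x - P₀ x) (dilate (u i) r φ)) atTop (𝓝 0) := by
    rw [Metric.tendsto_atTop]
    intro ε hε
    set I := r ^ n * ∫ x, ‖φ x‖ with hI
    have hI0 : 0 ≤ I := mul_nonneg (by positivity) (integral_nonneg fun _ => norm_nonneg _)
    obtain ⟨i₀, hi₀⟩ := hcau (R := r) hr.le (ε := ε / (I + 1)) (by positivity)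
    refine ⟨i₀, fun i hi => ?_⟩
    rw [dist_zero_right, Real.norm_eq_abs]
    refine (abs_ofFun_dilate_le (P := fun x => P i x - P₀ x) ((hci i).sub hc₀) (u i) hr φ
      (B := ε / (I + 1)) fun x hx => ?_).trans_lt ?_
    · refine le_of_tendsto ((tendsto_const_nhds.sub (hlim _)).norm)
        ((eventually_ge_atTop i₀).mono fun l hl => hi₀ i hi l hl _ ?_)
      rw [add_sub_cancel_left, norm_smul, Real.norm_of_nonneg hr.le]
      exact mul_le_of_le_one_right hr.le (mem_closedBall_zero_iff.1 (hφ hx))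
    · rw [mul_left_comm, ← hI, div_mul_eq_mul_div, div_lt_iff₀ (by positivity)]
      nlinarith
  have ht3 := (ht1.sub ht2).abs
  rw [sub_zero] at ht3
  refine le_of_tendsto' ht3 fun i => ?_
  have := hA i φ hφ B hB r hr hr1
  rw [ofFun_sub (hci i) hc₀]
  rw [sub_apply] at this ⊢
  rwa [sub_sub, add_comm (ofFun P₀ _), sub_add_cancel]

theorem isCompact_approxSet (T : Distrib n Y) {N : ℕ} (hs : (N : ℝ) - 1 < s) (j : ℕ) :
    IsCompact (approxSet T N s j) :=
  (isCompact_closedBall (0 : Rn n) j).of_isClosed_subset (isClosed_approxSet T hs j)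
    fun _ ha => mem_closedBall_zero_iff.2 ha.1

/-- Forward, the uniform boundedness principle supplies an order, a constant and a scale, and a
single `j` exceeding them all works. -/
theorem ptDiffHolderAt_iff [CompleteSpace Y] (T : Distrib n Y) (k : ℤ) (α : ℝ) (a : Rn n) :
    PtDiffHolderAt T k α a ↔ ∃ j, a ∈ approxSet T (k + 1).toNat (k + α) j := by
  have hexp : -(k : ℝ) - α - n = -((k : ℝ) + α + n) := by ring
  constructor
  · rintro ⟨P, hP, h⟩
    rw [hexp] at h
    obtain ⟨l, M, δ, hM0, hδ0, hM⟩ := exists_uniform_bound (T - ofFun P) a _ h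
    obtain ⟨j, hj⟩ := exists_nat_ge (max (max (l : ℝ) M) (max ‖a‖ (1 / δ)))
    obtain ⟨⟨hjl, hjM⟩, hja, hjδ⟩ := (max_le_iff.1 hj).imp max_le_iff.1 max_le_iff.1
    refine ⟨j, hja, P, isPolyOfDegreeLE_iff.1 hP, fun φ hφ B hB r hr hr1 => ?_⟩
    have hr2 : r ≤ δ := by
      refine hr1.trans ?_
      rw [div_le_iff₀ hδ0] at hjδ
      rw [div_le_iff₀ (by positivity)]
      nlinarith
    refine (hM φ hφ B (hB.mono (by exact_mod_cast hjl)) r hr hr2).trans ?_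
    have := hB.nonneg
    gcongr
  · rintro ⟨j, -, P, hP, h⟩
    refine ⟨P, isPolyOfDegreeLE_iff.2 hP, fun φ => ?_⟩
    obtain ⟨c, hc⟩ := h.exists_eventually_le φ
    refine lt_of_le_of_lt (b := (c : EReal)) ?_ (EReal.coe_lt_top c)
    refine limsup_le_of_le (by isBoundedDefault) ?_
    filter_upwards [hc, self_mem_nhdsWithin] with r hr hr0
    rw [mem_Ioi] at hr0
    rw [EReal.coe_le_coe_iff, hexp, Real.rpow_neg hr0.le, inv_mul_le_iff₀ (by positivity), mul_comm]
    exact (le_abs_self _).trans hr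

end GoodPoints

/-! ### Uniqueness of jets, lower order differentials, conclusion. -/

section Jets

/-- Evaluating at the multiples `c r` by the nodes and combining with the weights isolates `r^(e-m)
w e`, which for `e ≤ m` and `r ≤ 1` is at least `w e` in absolute value. -/
theorem eq_zero_of_tendsto_inv_pow_mul_sum {m : ℕ} {w : ℕ → ℝ}
    (h : Tendsto (fun r : ℝ => (r⁻¹) ^ m * ∑ i ∈ Finset.range (m + 1), r ^ i • w i)
      (𝓝[>] 0) (𝓝 0)) {e : ℕ} (he : e < m + 1) : w e = 0 := by
  have h1 : ∀ i ∈ Finset.range (m + 1), Tendsto (fun r : ℝ => coeffWeight (m + 1) e i *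
      ((((i : ℝ) + 1) / (m + 1 : ℕ)) ^ m * ((((((i : ℝ) + 1) / (m + 1 : ℕ)) * r)⁻¹) ^ m *
        ∑ q ∈ Finset.range (m + 1), ((((i : ℝ) + 1) / (m + 1 : ℕ)) * r) ^ q • w q)))
      (𝓝[>] 0) (𝓝 0) := by
    intro i hi
    have h0 := (node_mem (Finset.mem_range.1 hi)).1
    set c : ℝ := ((i : ℝ) + 1) / (m + 1 : ℕ)
    have h2 : Tendsto (fun r : ℝ => c * r) (𝓝[>] 0) (𝓝[>] 0) := by
      refine tendsto_nhdsWithin_iff.2 ⟨?_, ?_⟩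
      · have : Tendsto (fun r : ℝ => c * r) (𝓝 0) (𝓝 (c * 0)) :=
          (continuous_const_mul c).tendsto 0
        rw [mul_zero] at this
        exact this.mono_left nhdsWithin_le_nhds
      · exact eventually_mem_nhdsWithin.mono fun r (hr : 0 < r) => mul_pos h0 hr
    have h3 := ((h.comp h2).const_mul (c ^ m)).const_mul (coeffWeight (m + 1) e i)
    rw [mul_zero, mul_zero] at h3
    exact h3
  have h3 := tendsto_finsetSum _ h1
  rw [Finset.sum_const_zero] at h3
  have h4 := h3.abs
  rw [abs_zero] at h4
  refine abs_nonpos_iff.1 (ge_of_tendsto h4 ?_)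
  filter_upwards [Ioc_mem_nhdsGT (one_pos (α := ℝ))] with r hr
  have h5 := sum_coeffWeight_smul he fun q => r ^ q • w q
  have h6 : ∑ i ∈ Finset.range (m + 1), coeffWeight (m + 1) e i *
      ((((i : ℝ) + 1) / (m + 1 : ℕ)) ^ m * ((((((i : ℝ) + 1) / (m + 1 : ℕ)) * r)⁻¹) ^ m *
        ∑ q ∈ Finset.range (m + 1), ((((i : ℝ) + 1) / (m + 1 : ℕ)) * r) ^ q • w q)) =
      (r⁻¹) ^ m * (r ^ e * w e) := by
    rw [← smul_eq_mul (r ^ e), ← h5, Finset.mul_sum]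
    refine Finset.sum_congr rfl fun i hi => ?_
    have h0 := (node_mem (Finset.mem_range.1 hi)).1
    set c : ℝ := ((i : ℝ) + 1) / (m + 1 : ℕ)
    simp only [mul_inv, mul_pow, smul_eq_mul, mul_assoc]
    rw [← mul_assoc (c ^ m), ← mul_pow, mul_inv_cancel₀ h0.ne', one_pow, one_mul]
    ring
  rw [h6, ← mul_assoc, abs_mul]
  refine le_mul_of_one_le_left (abs_nonneg _) ?_
  rw [abs_of_nonneg (by have := hr.1; positivity), inv_pow, ← div_eq_inv_mul,
    one_le_div (pow_pos hr.1 m)]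
  exact pow_le_pow_of_le_one hr.1.le hr.2 (by omega)

variable {n : ℕ} {Y : Type*} [NormedAddCommGroup Y] [NormedSpace ℝ Y]

/-- The kernel centred at `a + r (x - a)` at scale `r` reads off `P - Q` along the line from `a` to
`x`, where it must be `o(r^m)`. Uniqueness makes the choice in `ptD` computable from any witness. -/
theorem IsJetPoly.unique {T : Distrib n Y} {m : ℕ} {a : Rn n} {P Q : Rn n → StrongDual ℝ Y}
    (hP : IsJetPoly T m a P) (hQ : IsJetPoly T m a Q) : P = Q := by
  have hP1 : IsPolyLT (m + 1) P := by simpa using isPolyOfDegreeLE_iff.1 hP.1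
  have hQ1 : IsPolyLT (m + 1) Q := by simpa using isPolyOfDegreeLE_iff.1 hQ.1
  have hR := hP1.sub hQ1
  ext x y
  obtain ⟨w, hw, -⟩ := hR.line a (x - a)
  have hw0 : ∀ i < m + 1, w i y = 0 := fun i hi => by
    refine eq_zero_of_tendsto_inv_pow_mul_sum (m := m) (w := fun i => w i y) ?_ hi
    have h1 := (hQ.2 (dilate (x - a) 1 (reproTest (m + 1) y))).sub
      (hP.2 (dilate (x - a) 1 (reproTest (m + 1) y)))
    rw [sub_zero] at h1
    refine h1.congr' ?_
    filter_upwards [self_mem_nhdsWithin] with r (hr : 0 < r)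
    rw [dilate_dilate a (x - a) hr.ne' one_ne_zero, mul_one]
    have h2 := ofFun_dilate_reproTest hR (a + r • (x - a)) hr y
    rw [ofFun_sub hP.1.continuous hQ.1.continuous, hw] at h2
    rw [← mul_sub, sub_apply, sub_apply, sub_sub_sub_cancel_left, h2, Int.cast_natCast,
      Real.rpow_sub hr, Real.rpow_neg hr.le, Real.rpow_natCast, Real.rpow_natCast, sum_apply,
      inv_pow, ← mul_assoc, div_mul_cancel₀ _ (pow_pos hr n).ne']
    rfl
  have h3 := hw 1
  rw [one_smul, add_sub_cancel] at h3
  have h4 : (P x - Q x) y = 0 := by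
    rw [h3, sum_apply]
    refine Finset.sum_eq_zero fun i hi => ?_
    rw [smul_apply, hw0 i (Finset.mem_range.1 hi), smul_zero]
  exact sub_eq_zero.1 h4

theorem IsJetPoly.ptD_eq {T : Distrib n Y} {m : ℕ} {a : Rn n} {P : Rn n → StrongDual ℝ Y}
    (hP : IsJetPoly T m a P) : ptD m T a = iteratedFDeriv ℝ m P a := by
  have h : PtDiffAt T m a := ⟨P, hP⟩
  rw [ptD, dif_pos h, h.choose_spec.unique hP]

/-- After normalization the error of `P` is `O(r^(s-m))`, and the discarded Taylor terms, being
`O(‖x - a‖^(m+1))`, contribute `O(r)`. -/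
theorem IsApprox.exists_isJetPoly {T : Distrib n Y} {j N m : ℕ} {s : ℝ} {a : Rn n}
    {P : Rn n → StrongDual ℝ Y} (hP : IsPolyLT N P) (h : IsApprox T j s a P) (hm : (m : ℝ) < s) :
    ∃ Q, IsJetPoly T m a Q ∧ iteratedFDeriv ℝ m Q a = iteratedFDeriv ℝ m P a := by
  obtain ⟨Q, hQ, hQD, C, hC0, hC⟩ := hP.exists_truncation a m
  refine ⟨Q, ⟨isPolyOfDegreeLE_iff.2 (by simpa using hQ), fun φ => ?_⟩, hQD⟩
  have hPc := (hP.contDiff (m := 0)).continuous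
  have hQc := (hQ.contDiff (m := 0)).continuous
  obtain ⟨c, hc⟩ := h.exists_eventually_le φ
  obtain ⟨R, hR0, hR⟩ := φ.hasCompactSupport.isCompact.isBounded.subset_closedBall_lt 0 (0 : Rn n)
  set D := C * R ^ (m + 1) * ∫ x, ‖φ x‖ with hD
  have hlim : Tendsto (fun r : ℝ => c * r ^ (s - m) + D * r) (𝓝[>] 0) (𝓝 0) := by
    have h1 : Tendsto (fun r : ℝ => c * r ^ (s - m) + D * r) (𝓝 0)
        (𝓝 (c * 0 ^ (s - m) + D * 0)) :=
      (((Real.continuousAt_rpow_const 0 (s - m) (Or.inr (by linarith))).tendsto).const_mul c).add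
        ((continuous_const_mul D).tendsto 0)
    rw [Real.zero_rpow (by linarith), mul_zero, mul_zero, add_zero] at h1
    exact h1.mono_left nhdsWithin_le_nhds
  refine squeeze_zero_norm' ?_ hlim
  filter_upwards [hc, Ioc_mem_nhdsGT (inv_pos.2 hR0)] with r hr hr0
  have hrpos := hr0.1
  have h2 : |ofFun (fun x => P x - Q x) (dilate a r φ)| ≤
      r ^ n * (C * (r * R) ^ (m + 1) * ∫ x, ‖φ x‖) := by
    refine abs_ofFun_dilate_le (P := fun x => P x - Q x) (hPc.sub hQc) a hrpos φ fun x hx => ?_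
    have h3 : ‖r • x‖ ≤ r * R := by
      rw [norm_smul, Real.norm_of_nonneg hrpos.le]
      exact mul_le_mul_of_nonneg_left (mem_closedBall_zero_iff.1 (hR hx)) hrpos.le
    have h4 : r * R ≤ 1 := by
      have := mul_le_mul_of_nonneg_right hr0.2 hR0.le
      rwa [inv_mul_cancel₀ hR0.ne'] at this
    have h5 := hC (a + r • x) (by rw [add_sub_cancel_left]; exact h3.trans h4)
    rw [add_sub_cancel_left] at h5
    exact h5.trans (by gcongr)
  have h6 : (T - ofFun Q) (dilate a r φ) =
      (T - ofFun P) (dilate a r φ) + ofFun (fun x => P x - Q x) (dilate a r φ) := by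
    rw [ofFun_sub hPc hQc, sub_apply, sub_apply, sub_add_sub_cancel]
  rw [h6, norm_mul, Real.norm_of_nonneg (by positivity), Real.norm_eq_abs]
  have h7 : r ^ (-((m : ℤ) : ℝ) - n) * (c * r ^ (s + n)) = c * r ^ (s - m) := by
    rw [mul_left_comm, ← Real.rpow_add hrpos, Int.cast_natCast]
    congr 2
    ring
  have h8 : r ^ (-((m : ℤ) : ℝ) - n) * (r ^ n * (C * (r * R) ^ (m + 1) * ∫ x, ‖φ x‖)) = D * r := by
    rw [Int.cast_natCast, Real.rpow_sub hrpos, Real.rpow_neg hrpos.le, Real.rpow_natCast,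
      Real.rpow_natCast, hD, mul_pow, pow_succ r]
    field_simp
  rw [← h7, ← h8, ← mul_add]
  gcongr
  exact (abs_add_le _ _).trans (add_le_add hr h2)

theorem exists_isCompact_and_isOfClass (n : ℕ) (k : ℤ) (α : ℝ) (hα0 : 0 < α) (hα1 : α ≤ 1) (hkα : 0 ≤ (k : ℝ) + α)
    {Y : Type*} [NormedAddCommGroup Y] [NormedSpace ℝ Y] [CompleteSpace Y]
    (T : Distrib n Y) :
    ∃ C : ℕ → Set (Rn n),
      (∀ j, IsCompact (C j)) ∧
      {a | PtDiffHolderAt T k α a} = (⋃ j, C j) ∧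
      (0 ≤ k →
        ∃ f : ℕ → Rn n → StrongDual ℝ Y,
          ∀ j, IsOfClass k.toNat α (f j) ∧
            ∀ a ∈ C j, ∀ m : ℕ, (m : ℤ) ≤ k →
              PtDiffAt T m a ∧
                ptD m T a = iteratedFDeriv ℝ m (f j) a) := by
  -- Hence `(k + 1).toNat` is `k + 1` without truncation, and the degree bound `k` is below `k + α`.
  have hk1 : -1 ≤ k := by
    by_contra! hk
    have : (k : ℝ) ≤ -2 := by exact_mod_cast (by omega : k ≤ -2)
    linarith
  have hs : (((k + 1).toNat : ℕ) : ℝ) - 1 < k + α := by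
    have : (((k + 1).toNat : ℤ) : ℝ) = k + 1 := by
      rw [Int.toNat_of_nonneg (by omega)]; push_cast; ring
    rw [Int.cast_natCast] at this
    linarith
  refine ⟨approxSet T (k + 1).toNat (k + α), isCompact_approxSet T hs, ?_, fun hk => ?_⟩
  · ext a
    rw [mem_ofPred_eq, ptDiffHolderAt_iff, mem_iUnion]
  obtain ⟨K, rfl⟩ := Int.eq_ofNat_of_zero_le hk
  have hK : ((K : ℤ) + 1).toNat = K + 1 := by omega
  rw [hK, Int.cast_natCast, Int.toNat_natCast]
  have hex : ∀ j, ∃ f : Rn n → StrongDual ℝ Y, IsOfClass K α f ∧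
      ∀ a ∈ approxSet T (K + 1) (K + α) j, ∀ m : ℕ, (m : ℤ) ≤ K →
        PtDiffAt T m a ∧ ptD m T a = iteratedFDeriv ℝ m f a := by
    intro j
    choose! P hP hA using fun a (ha : a ∈ approxSet T (K + 1) (K + α) j) => ha.2
    obtain ⟨M, r₀, hW⟩ := isWhitneyField_of_isApprox T K j (K + α) P _ hP hA
    have hb : Bornology.IsBounded (approxSet T (K + 1) (K + α) j) :=
      Metric.isBounded_closedBall.subset fun a ha => mem_closedBall_zero_iff.2 ha.1
    obtain ⟨f, hf, hfP⟩ := hW.exists_extension hb hα0 hα1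
    refine ⟨f, hf, fun a ha m hm => ?_⟩
    have hmK : m ≤ K := by exact_mod_cast hm
    have hms : (m : ℝ) < K + α := by
      have : (m : ℝ) ≤ K := by exact_mod_cast hmK
      linarith
    obtain ⟨Q, hQ, hQD⟩ := (hA a ha).exists_isJetPoly (hP a ha) hms
    exact ⟨⟨Q, hQ⟩, by rw [hQ.ptD_eq, hQD, hfP a ha m hmK]⟩
  choose f hf using hex
  exact ⟨f, hf⟩

end Jets

end PointwiseDiff

theorem theorem4p10 (n : ℕ) (k : ℤ) (α : ℝ) (hα0 : 0 < α) (hα1 : α ≤ 1) (hkα : 0 ≤ (k : ℝ) + α)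
    {Y : Type*} [NormedAddCommGroup Y] [NormedSpace ℝ Y] [CompleteSpace Y]
    (T : PointwiseDiff.Distrib n Y) :
    ∃ C : ℕ → Set (PointwiseDiff.Rn n),
      (∀ j, IsCompact (C j)) ∧
      {a | PointwiseDiff.PtDiffHolderAt T k α a} = (⋃ j, C j) ∧
      (0 ≤ k →
        ∃ f : ℕ → PointwiseDiff.Rn n → StrongDual ℝ Y,
          ∀ j, PointwiseDiff.IsOfClass k.toNat α (f j) ∧
            ∀ a ∈ C j, ∀ m : ℕ, (m : ℤ) ≤ k →
              PointwiseDiff.PtDiffAt T m a ∧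
                PointwiseDiff.ptD m T a = iteratedFDeriv ℝ m (f j) a) :=
  PointwiseDiff.exists_isCompact_and_isOfClass n k α hα0 hα1 hkα T
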